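/- Let $d\ge 1$ be an integer and let $\beta\in(0,1]$, where $\beta=1$ is allowed only if $d\le 2$. For constants $C_b,C_c,C_d>0$ let $\Sigma_B=\Sigma_B(\beta,C_b,C_c,C_d)$ be the set of all twice continuously differentiable probability density functions $f:\mathbb{R}^d\to[0,\infty)$ (with respect to Lebesgue measure) such that, with the convention $0\cdot\ln(1/0)=0$, (a) $f(x)\le 1$ for all $x\in\mathbb{R}^d$; (b) $\|\nabla f(x)\|\le C_b\, f(x)\left(1+\ln\frac{1}{f(x)}\right)$ for all $x\in\mathbb{R}^d$, where $\|\cdot\|$ is the Euclidean norm; (c) $\|\nabla^2 f(x)\|_{op}\le C_c\, f(x)\left(1+\ln\frac{1}{f(x)}\right)$ for all $x\in\mathbb{R}^d$, where $\|\cdot\|_{op}$ is the operator norm; (d) $\mathrm{P}(f(X)<t)\le C_d\, t^\beta$ for all $t>0$, where $X$ is a random vector with density $f$. Then there are constants $C_0>0$ and $c>0$, depending only on $d$ and $\beta$, such that for all $C_b,C_c,C_d\ge C_0$ and every integer $N\ge 1$ $$\inf_{\hat f}\ \sup_{f\in\Sigma_B}\ \mathbb{E}\left[\|\hat f-f\|_1\right]\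 \ge\ c\,N^{-\min\left\{\beta,\frac{2}{d+4}\right\}},$$ where the infimum is over all estimators $\hat f$, that is, all jointly measurable functions $\hat f(x)=\hat f(X_1,\dots,X_N;x)\in\mathbb{R}$ of the sample and of the point $x\in\mathbb{R}^d$, the expectation is over i.i.d. samples $X_1,\dots,X_N$ with density $f$, and $\|\hat f-f\|_1=\int_{\mathbb{R}^d}|\hat f(x)-f(x)|\,dx$ (the value $+\infty$ being allowed). -/

import Mathlib

open MeasureTheory
open scoped ENNReal

noncomputable section

namespace DensityEstimation

/-- The space `ℝ^d` with its Euclidean norm and Lebesgue measure. -/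
abbrev Space (d : ℕ) : Type := EuclideanSpace ℝ (Fin d)

/-- The measure on `ℝ^d` with Lebesgue density `f`. -/
def law {d : ℕ} (f : Space d → ℝ) : Measure (Space d) :=
  (volume : Measure (Space d)).withDensity fun x => ENNReal.ofReal (f x)

/-- The bound `C · y · (1 + ln (1 / y))` on the derivatives at a point where the density is `y`.
At `y = 0` it is `0`, the usual convention for `0 · ln (1 / 0)`. -/
def decayBound (C y : ℝ) : ℝ := C * y * (1 + Real.log (1 / y))

/-- The class of twice continuously differentiable probability density functions `f` on `ℝ^d`
that are at most `1`, whose gradient and Hessian decay with `f`, and whose tail is controlled by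
`P(f(X) < t) ≤ C_d t ^ β`. -/
structure IsSmoothTailDensity {d : ℕ} (β Cb Cc Cd : ℝ) (f : Space d → ℝ) : Prop where
  nonneg : ∀ x, 0 ≤ f x
  /-- total mass one -/
  lintegral_eq_one : ∫⁻ x, ENNReal.ofReal (f x) = 1
  contDiff : ContDiff ℝ 2 f
  le_one : ∀ x, f x ≤ 1
  norm_gradient_le : ∀ x, ‖gradient f x‖ ≤ decayBound Cb (f x)
  /-- The Hessian is the derivative of the gradient, a linear operator on `ℝ^d`;
  the norm is the operator norm. -/
  norm_hessian_le : ∀ x, ‖fderiv ℝ (gradient f) x‖ ≤ decayBound Cc (f x)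
  tail_le : ∀ t : ℝ, 0 < t → law f {x | f x < t} ≤ ENNReal.ofReal (Cd * t ^ β)

/-- An estimator of a density on `ℝ^d` from `N` samples: a jointly measurable real function of
the samples and of the point at which the density is estimated. -/
structure Estimator (d N : ℕ) where
  toFun : (Fin N → Space d) → Space d → ℝ
  measurable_uncurry : Measurable (Function.uncurry toFun)

/-- The `ℓ₁` risk `E ‖f̂ - f‖₁` in `[0, ∞]`, for `N` i.i.d. samples with density `f`. -/
def l1Risk {d N : ℕ} (fhat : Estimator d N) (f : Space d → ℝ) : ℝ≥0∞ :=
  ∫⁻ X : Fin N → Space d, (∫⁻ x : Space d, ENNReal.ofReal |fhat.toFun X x - f x|)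
    ∂(Measure.pi fun _ : Fin N => law f)

/-- The minimax `ℓ₁` risk over the class, for sample size `N`: the infimum over all estimators of
the supremum of the risk over the class. -/
def minimaxL1Risk (d N : ℕ) (β Cb Cc Cd : ℝ) : ℝ≥0∞ :=
  ⨅ fhat : Estimator d N, ⨆ f : Space d → ℝ, ⨆ _ : IsSmoothTailDensity β Cb Cc Cd f,
    l1Risk fhat f

end DensityEstimation

end

noncomputable section

namespace DensityEstimation

/-! The bound comes from Assouad's lemma with a two-parameter family of hard instances. For `0 < v ≤
1` there is a density in the class which is at least of order `v` on a ball of radius of order `L`,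
where `v * L ^ d = v ^ β`. It is a mixture of two Gaussians, one of width 1 and one of width `L` and
height of order `v` (`exists_base_density`). The logarithm in the decay conditions pays for the
polynomial factors that appear when a Gaussian is differentiated. Gaussian tails satisfy the tail
condition for every `β < 1`, and for `β = 1` when `d ≤ 2`.

On that ball put about `(L / h) ^ d` disjoint mean-zero bumps of width `h ≤ 1` and height of order
`v * h ^ 2`, with arbitrary signs. Their derivatives up to order two are `O(v)`, so every signed sum
stays in the class (`TailProfile.add_perturbation`). One sign cannot be detected from `N` samples
when the squared norm of a bump, divided by `v`, is `O(1 / N)`, that is, when `v * h ^ (d + 4) ≤ 1 /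
N`. Assouad's lemma (`IsBumpFamily.exists_l1Risk_ge`) then bounds the risk below by the total `L¹`
norm of the bumps, of order `L ^ d * v * h ^ 2 = v ^ β * h ^ 2` (`exists_le_minimaxL1Risk`).

The two extreme choices `v = 1 / N, h = 1` and `v = 1, h = N ^ (-1 / (d + 4))` give the two
exponents. -/

/-! ### Product densities and the affinity of `N`-fold products. -/

theorem lintegral_pi_fin_prod {α : Type*} [MeasurableSpace α] (μ : Measure α) [SigmaFinite μ]
    {n : ℕ} {f : Fin n → α → ℝ≥0∞} (hf : ∀ i, Measurable (f i)) :
    ∫⁻ x : Fin n → α, ∏ i, f i (x i) ∂(Measure.pi fun _ => μ) = ∏ i, ∫⁻ x, f i x ∂μ := by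
  induction n with
  | zero => simp
  | succ n ih =>
    have hm : Measurable fun y : Fin n → α => ∏ i : Fin n, f i.succ (y i) :=
      Finset.measurable_prod _ fun i _ => (hf i.succ).comp (measurable_pi_apply i)
    calc
      _ = ∫⁻ x : α × (Fin n → α), f 0 x.1 * ∏ i : Fin n, f i.succ (x.2 i)
            ∂(μ.prod (Measure.pi fun _ => μ)) := by
          rw [← ((measurePreserving_piFinSuccAbove (fun _ => μ) 0).symm).lintegral_comp_emb
            (MeasurableEquiv.measurableEmbedding _)]
          simp_rw [MeasurableEquiv.piFinSuccAbove_symm_apply, Fin.insertNthEquiv,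
            Fin.prod_univ_succ, Fin.insertNth_zero, Equiv.coe_fn_mk, Fin.cons_succ,
            Fin.cons_zero]
          rfl
      _ = (∫⁻ x, f 0 x ∂μ) * ∏ i : Fin n, ∫⁻ x, f i.succ x ∂μ := by
          rw [← ih fun i => hf i.succ]
          exact lintegral_prod_mul (hf 0).aemeasurable hm.aemeasurable
      _ = _ := by rw [Fin.prod_univ_succ]

theorem pi_withDensity {α : Type*} [MeasurableSpace α] (μ : Measure α) [SigmaFinite μ]
    {n : ℕ} {g : α → ℝ≥0∞} (hg : Measurable g) [SigmaFinite (μ.withDensity g)] :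
    (Measure.pi fun _ : Fin n => μ.withDensity g) =
      (Measure.pi fun _ : Fin n => μ).withDensity fun x => ∏ i, g (x i) := by
  refine Measure.pi_eq fun s hs => ?_
  rw [withDensity_apply _ (MeasurableSet.univ_pi hs),
    ← lintegral_indicator (MeasurableSet.univ_pi hs)]
  have : (Set.univ.pi s).indicator (fun x : Fin n → α => ∏ i, g (x i)) =
      fun x => ∏ i, (s i).indicator g (x i) := by
    ext x
    by_cases hx : x ∈ Set.univ.pi s
    · rw [Set.indicator_of_mem hx]
      exact Finset.prod_congr rfl fun i _ =>
        (Set.indicator_of_mem (hx i (Set.mem_univ i)) _).symm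
    · rw [Set.indicator_of_notMem hx]
      obtain ⟨i, hi⟩ : ∃ i, x i ∉ s i := by simpa [Set.mem_pi] using hx
      exact (Finset.prod_eq_zero (Finset.mem_univ i) (Set.indicator_of_notMem hi _)).symm
  rw [this, lintegral_pi_fin_prod μ fun i => hg.indicator (hs i)]
  refine Finset.prod_congr rfl fun i _ => ?_
  rw [withDensity_apply _ (hs i), lintegral_indicator (hs i)]

/-- Two-point comparison: if `r ^ 2 ≤ p q`, then the affinity `min p q` is controlled by `r`. -/
theorem ofReal_le_two_mul_min_add {r p q : ℝ} (hp : 0 ≤ p) (hq : 0 ≤ q)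
    (h : r ^ 2 ≤ p * q) :
    ENNReal.ofReal r ≤ 2 * min (ENNReal.ofReal p) (ENNReal.ofReal q) +
      (ENNReal.ofReal p + ENNReal.ofReal q) / 8 := by
  -- If `p ≤ q`, then `(2p + q/8)² = (2p - q/8)² + pq ≥ r²`. The weight 1/8 is chosen so that the
  -- two error terms integrate to 1/4, below the 1/2 that Bernoulli's inequality provides.
  have key : r ≤ 2 * min p q + (p + q) / 8 := by
    rcases le_total p q with hpq | hpq
    · rw [min_eq_left hpq]
      nlinarith [sq_nonneg (2 * p - q / 8), sq_nonneg (r - (2 * p + q / 8))]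
    · rw [min_eq_right hpq]
      nlinarith [sq_nonneg (2 * q - p / 8), sq_nonneg (r - (2 * q + p / 8))]
  refine (ENNReal.ofReal_le_ofReal key).trans (le_of_eq ?_)
  rw [ENNReal.ofReal_add (by positivity) (by positivity), ENNReal.ofReal_mul (by norm_num),
    ENNReal.ofReal_div_of_pos (by norm_num), ENNReal.ofReal_add hp hq, ENNReal.ofReal_min]
  norm_num

theorem prod_sq_le_prod_mul {N : ℕ} {r p q : Fin N → ℝ} (h : ∀ j, r j ^ 2 ≤ p j * q j) :
    (∏ j, r j) ^ 2 ≤ (∏ j, p j) * ∏ j, q j := by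
  rw [← Finset.prod_pow, ← Finset.prod_mul_distrib]
  exact Finset.prod_le_prod (fun j _ => sq_nonneg _) fun j _ => h j

/-- The affinity of two `N`-fold product measures with densities `p`, `q` is bounded below,
if `r ≤ √(p q)` has integral at least `1 - 1 / (2 N)`. -/
theorem affinity_pi_ge {α : Type*} [MeasurableSpace α] (μ : Measure α) [SigmaFinite μ]
    {N : ℕ} (hN : 1 ≤ N) {p q r : α → ℝ} (hpm : Measurable p) (hqm : Measurable q)
    (hrm : Measurable r) (hp : ∀ x, 0 ≤ p x) (hq : ∀ x, 0 ≤ q x) (hr : ∀ x, 0 ≤ r x)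
    (hrpq : ∀ x, r x ^ 2 ≤ p x * q x)
    (hp1 : ∫⁻ x, ENNReal.ofReal (p x) ∂μ = 1) (hq1 : ∫⁻ x, ENNReal.ofReal (q x) ∂μ = 1)
    (hr1 : ENNReal.ofReal (1 - 1 / (2 * N)) ≤ ∫⁻ x, ENNReal.ofReal (r x) ∂μ) :
    1 / 8 ≤ ∫⁻ X : Fin N → α, min (∏ j, ENNReal.ofReal (p (X j))) (∏ j, ENNReal.ofReal (q (X j)))
      ∂(Measure.pi fun _ => μ) := by
  have hN' : (1 : ℝ) ≤ N := by exact_mod_cast hN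
  have meas : ∀ {g : α → ℝ}, Measurable g →
      Measurable fun X : Fin N → α => ∏ j, ENNReal.ofReal (g (X j)) := fun {g} hg =>
    Finset.measurable_prod _ fun j _ =>
      (ENNReal.measurable_ofReal.comp hg).comp (measurable_pi_apply j)
  have int : ∀ {g : α → ℝ}, Measurable g →
      ∫⁻ X : Fin N → α, ∏ j, ENNReal.ofReal (g (X j)) ∂(Measure.pi fun _ => μ) =
        (∫⁻ x, ENNReal.ofReal (g x) ∂μ) ^ N := fun {g} hg => by
    rw [lintegral_pi_fin_prod μ (f := fun _ x => ENNReal.ofReal (g x))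
      fun _ => ENNReal.measurable_ofReal.comp hg]
    simp
  set m : ℝ≥0∞ := ∫⁻ X : Fin N → α,
    min (∏ j, ENNReal.ofReal (p (X j))) (∏ j, ENNReal.ofReal (q (X j)))
      ∂(Measure.pi fun _ => μ)
  -- The integral of `∏ r (X j)` is the `N`-th power of that of `r`, hence at least 1/2 by
  -- Bernoulli. Integrating the two-point comparison bounds it above by `2m + 1/4`.
  have h1 : (1 / 2 : ℝ≥0∞) ≤ 2 * m + 1 / 4 := by
    calc (1 / 2 : ℝ≥0∞) = ENNReal.ofReal (1 / 2) := by
          rw [ENNReal.ofReal_div_of_pos (by norm_num)]; norm_num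
      _ ≤ ENNReal.ofReal ((1 - 1 / (2 * N)) ^ N) := by
          refine ENNReal.ofReal_le_ofReal ?_
          have hle : 1 / (2 * (N : ℝ)) ≤ 1 := by
            rw [div_le_one (by positivity)]; linarith
          have := one_add_mul_le_pow (a := -(1 / (2 * (N : ℝ)))) (by linarith) N
          have h2 : (N : ℝ) * -(1 / (2 * (N : ℝ))) = -(1 / 2) := by field_simp
          rw [h2] at this
          rw [sub_eq_add_neg]
          linarith
      _ = ENNReal.ofReal (1 - 1 / (2 * N)) ^ N := by
          rw [ENNReal.ofReal_pow]
          have hle : 1 / (2 * (N : ℝ)) ≤ 1 := by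
            rw [div_le_one (by positivity)]; linarith
          linarith
      _ ≤ (∫⁻ x, ENNReal.ofReal (r x) ∂μ) ^ N := by gcongr
      _ = ∫⁻ X : Fin N → α, ∏ j, ENNReal.ofReal (r (X j)) ∂(Measure.pi fun _ => μ) :=
          (int hrm).symm
      _ ≤ ∫⁻ X : Fin N → α,
            (2 * min (∏ j, ENNReal.ofReal (p (X j))) (∏ j, ENNReal.ofReal (q (X j))) +
            (∏ j, ENNReal.ofReal (p (X j)) + ∏ j, ENNReal.ofReal (q (X j))) / 8)
            ∂(Measure.pi fun _ => μ) := by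
          refine lintegral_mono fun X => ?_
          have := ofReal_le_two_mul_min_add (Finset.prod_nonneg fun j _ => hp (X j))
            (Finset.prod_nonneg fun j _ => hq (X j))
            (prod_sq_le_prod_mul (r := fun j => r (X j)) fun j => hrpq (X j))
          rwa [ENNReal.ofReal_prod_of_nonneg fun j _ => hp (X j),
            ENNReal.ofReal_prod_of_nonneg fun j _ => hq (X j),
            ENNReal.ofReal_prod_of_nonneg fun j _ => hr (X j)] at this
      _ = 2 * m + 1 / 4 := by
          simp_rw [div_eq_mul_inv]
          rw [lintegral_add_left (((meas hpm).min (meas hqm)).const_mul 2),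
            lintegral_const_mul _ ((meas hpm).min (meas hqm)),
            lintegral_mul_const (8⁻¹ : ℝ≥0∞) (f := fun X : Fin N → α =>
              ∏ j, ENNReal.ofReal (p (X j)) + ∏ j, ENNReal.ofReal (q (X j)))
              ((meas hpm).add (meas hqm)), lintegral_add_left (meas hpm),
            int hpm, int hqm, hp1, hq1]
          congr 1
          rw [one_pow, ← div_eq_mul_inv, ← div_eq_mul_inv,
            ENNReal.div_eq_div_iff (by norm_num) (by norm_num) (by norm_num) (by norm_num)]
          norm_num
  by_contra! hlt
  have hmt : m ≠ ⊤ := (hlt.trans (by simp)).ne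
  clear_value m
  lift m to NNReal using hmt
  have e1 : (1 / 2 : ℝ≥0∞) = ((1 / 2 : NNReal) : ℝ≥0∞) := by
    rw [ENNReal.coe_div (by norm_num)]; norm_num
  have e2 : (1 / 4 : ℝ≥0∞) = ((1 / 4 : NNReal) : ℝ≥0∞) := by
    rw [ENNReal.coe_div (by norm_num)]; norm_num
  have e3 : (1 / 8 : ℝ≥0∞) = ((1 / 8 : NNReal) : ℝ≥0∞) := by
    rw [ENNReal.coe_div (by norm_num)]; norm_num
  rw [e3, ENNReal.coe_lt_coe] at hlt
  rw [e1, e2] at h1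
  have h1' : (1 / 2 : NNReal) ≤ 2 * m + 1 / 4 := by exact_mod_cast h1
  have hlt' : (m : ℝ) < 1 / 8 := by exact_mod_cast hlt
  have h1'' : (1 / 2 : ℝ) ≤ 2 * m + 1 / 4 := by exact_mod_cast h1'
  linarith

/-! ### Sign perturbations of a density and Assouad's lemma. -/

/-- The sign `±1` encoded by a Boolean. -/
def boolSign (b : Bool) : ℝ := if b then 1 else -1

theorem boolSign_not (b : Bool) : boolSign (!b) = -boolSign b := by
  cases b <;> simp [boolSign]

theorem abs_boolSign (b : Bool) : |boolSign b| = 1 := by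
  cases b <;> simp [boolSign]

theorem boolSign_sq (b : Bool) : boolSign b ^ 2 = 1 := by
  cases b <;> simp [boolSign]

/-- The function `f₀ + ∑ᵢ ± uᵢ`, with the signs prescribed by `σ`. -/
def perturbed {d : ℕ} {ι : Type*} [Fintype ι] (f₀ : Space d → ℝ) (u : ι → Space d → ℝ)
    (σ : ι → Bool) (x : Space d) : ℝ :=
  f₀ x + ∑ i, boolSign (σ i) * u i x

/-- Disjointly supported mean-zero perturbations `uᵢ` of a density `f₀`, of size at most `κ` and
living where `f₀` is at least `κ`. -/
structure IsBumpFamily {d : ℕ} {ι : Type*} (κ : ℝ) (f₀ : Space d → ℝ)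
    (u : ι → Space d → ℝ) : Prop where
  pos : 0 < κ
  measurable_base : Measurable f₀
  nonneg_base : ∀ x, 0 ≤ f₀ x
  lintegral_base : ∫⁻ x, ENNReal.ofReal (f₀ x) = 1
  measurable_bump : ∀ i, Measurable (u i)
  integrable_bump : ∀ i, Integrable (u i)
  integral_bump : ∀ i, ∫ x, u i x = 0
  abs_bump_le : ∀ i x, |u i x| ≤ κ
  le_base : ∀ i x, u i x ≠ 0 → κ ≤ f₀ x
  disjoint : ∀ i j x, i ≠ j → u i x ≠ 0 → u j x = 0

namespace IsBumpFamily

variable {d : ℕ} {ι : Type*} {κ : ℝ} {f₀ : Space d → ℝ}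
  {u : ι → Space d → ℝ}

theorem integrable_base (h : IsBumpFamily κ f₀ u) : Integrable f₀ := by
  refine ⟨h.measurable_base.aestronglyMeasurable, ?_⟩
  rw [hasFiniteIntegral_iff_ofReal (Filter.Eventually.of_forall h.nonneg_base), h.lintegral_base]
  exact ENNReal.one_lt_top

theorem integral_base (h : IsBumpFamily κ f₀ u) : ∫ x, f₀ x = 1 := by
  rw [integral_eq_lintegral_of_nonneg_ae (Filter.Eventually.of_forall h.nonneg_base)
    h.measurable_base.aestronglyMeasurable, h.lintegral_base, ENNReal.toReal_one]

/-- Changing the sign of the `i`-th bump. -/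
def flip [DecidableEq ι] (i : ι) (σ : ι → Bool) : ι → Bool := Function.update σ i (!σ i)

theorem flip_involutive [DecidableEq ι] (i : ι) :
    Function.Involutive (flip i : (ι → Bool) → ι → Bool) := fun σ => by
  simp [flip]

theorem measurableSet_bump (h : IsBumpFamily κ f₀ u) (i : ι) :
    MeasurableSet {x | u i x ≠ 0} :=
  (h.measurable_bump i (measurableSet_singleton 0)).compl

variable [Fintype ι]

theorem sum_eq_single (h : IsBumpFamily κ f₀ u) (σ : ι → Bool) {i : ι} {x : Space d}
    (hx : u i x ≠ 0) : ∑ j, boolSign (σ j) * u j x = boolSign (σ i) * u i x :=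
  Finset.sum_eq_single i (fun j _ hj => by rw [h.disjoint i j x hj.symm hx, mul_zero])
    fun hi => absurd (Finset.mem_univ i) hi

theorem abs_sum_le (h : IsBumpFamily κ f₀ u) (σ : ι → Bool) (x : Space d) :
    |∑ j, boolSign (σ j) * u j x| ≤ κ ∧
      ((∑ j, boolSign (σ j) * u j x) ≠ 0 → κ ≤ f₀ x) := by
  by_cases hx : ∃ i, u i x ≠ 0
  · obtain ⟨i, hi⟩ := hx
    rw [h.sum_eq_single σ hi, abs_mul, abs_boolSign, one_mul]
    exact ⟨h.abs_bump_le i x, fun _ => h.le_base i x hi⟩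
  · push Not at hx
    simp [hx, h.pos.le]

theorem perturbed_nonneg (h : IsBumpFamily κ f₀ u) (σ : ι → Bool) (x : Space d) :
    0 ≤ perturbed f₀ u σ x := by
  obtain ⟨h1, h2⟩ := h.abs_sum_le σ x
  unfold perturbed
  by_cases h0 : ∑ j, boolSign (σ j) * u j x = 0
  · rw [h0, add_zero]; exact h.nonneg_base x
  · have := h2 h0
    have := (abs_le.mp h1).1
    linarith

theorem measurable_perturbed (h : IsBumpFamily κ f₀ u) (σ : ι → Bool) :
    Measurable (perturbed f₀ u σ) :=
  h.measurable_base.add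
    (Finset.measurable_sum _ fun i _ => (h.measurable_bump i).const_mul _)

theorem integrable_perturbed (h : IsBumpFamily κ f₀ u) (σ : ι → Bool) :
    Integrable (perturbed f₀ u σ) :=
  h.integrable_base.add
    (integrable_finsetSum _ fun i _ => (h.integrable_bump i).const_mul _)

theorem integral_perturbed (h : IsBumpFamily κ f₀ u) (σ : ι → Bool) :
    ∫ x, perturbed f₀ u σ x = 1 := by
  unfold perturbed
  rw [integral_add h.integrable_base
    (integrable_finsetSum _ fun i _ => (h.integrable_bump i).const_mul _),
    integral_finsetSum _ fun i _ => (h.integrable_bump i).const_mul _, h.integral_base]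
  simp [integral_const_mul, h.integral_bump]

theorem lintegral_perturbed (h : IsBumpFamily κ f₀ u) (σ : ι → Bool) :
    ∫⁻ x, ENNReal.ofReal (perturbed f₀ u σ x) = 1 := by
  rw [← ofReal_integral_eq_lintegral_ofReal (h.integrable_perturbed σ)
    (Filter.Eventually.of_forall (h.perturbed_nonneg σ)), h.integral_perturbed, ENNReal.ofReal_one]

theorem perturbed_flip [DecidableEq ι] (i : ι) (σ : ι → Bool) (x : Space d) :
    perturbed f₀ u (flip i σ) x = perturbed f₀ u σ x - 2 * (boolSign (σ i) * u i x) := by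
  unfold perturbed flip
  rw [← Finset.add_sum_erase _ _ (Finset.mem_univ i),
    ← Finset.add_sum_erase _ (fun j => boolSign (σ j) * u j x) (Finset.mem_univ i),
    Finset.sum_congr rfl fun j hj => by
      rw [Function.update_of_ne (Finset.ne_of_mem_erase hj)]]
  rw [Function.update_self, boolSign_not]
  ring

/-- A minorant of the geometric mean of the two densities differing in the `i`-th sign. -/
theorem exists_sq_le_mul [DecidableEq ι] (h : IsBumpFamily κ f₀ u) {N : ℕ}
    (hu : ∀ i, (∫ x, u i x ^ 2) ≤ κ / (2 * N)) (i : ι) (σ : ι → Bool) :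
    ∃ r : Space d → ℝ, Measurable r ∧ (∀ x, 0 ≤ r x) ∧
      (∀ x, r x ^ 2 ≤ perturbed f₀ u σ x * perturbed f₀ u (flip i σ) x) ∧
      ENNReal.ofReal (1 - 1 / (2 * N)) ≤ ∫⁻ x, ENNReal.ofReal (r x) := by
  have hκ := h.pos
  have hi2 : Integrable fun x => u i x ^ 2 := by
    refine ((h.integrable_bump i).norm.const_mul κ).mono'
      ((h.measurable_bump i).pow_const 2).aestronglyMeasurable
      (Filter.Eventually.of_forall fun x => ?_)
    rw [Real.norm_eq_abs, Real.norm_eq_abs, abs_pow, sq]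
    exact mul_le_mul_of_nonneg_right (h.abs_bump_le i x) (abs_nonneg _)
  have hint : Integrable fun x => perturbed f₀ u σ x - boolSign (σ i) * u i x :=
    (h.integrable_perturbed σ).sub ((h.integrable_bump i).const_mul _)
  have on : ∀ x, u i x ≠ 0 → perturbed f₀ u σ x - boolSign (σ i) * u i x = f₀ x := fun x hx => by
    unfold perturbed; rw [h.sum_eq_single σ hx]; ring
  have hnn : ∀ x, 0 ≤ perturbed f₀ u σ x - boolSign (σ i) * u i x - u i x ^ 2 / κ := fun x => by
    by_cases hx : u i x = 0
    · simpa [hx] using h.perturbed_nonneg σ x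
    · rw [on x hx]
      have h1 := h.le_base i x hx
      have h2 := h.abs_bump_le i x
      have h3 : u i x ^ 2 / κ ≤ κ := by
        rw [div_le_iff₀ hκ, ← sq_abs]; nlinarith [abs_nonneg (u i x)]
      linarith
  -- Off the support of `u i` the two densities agree and `r` is their common value. On it their
  -- geometric mean is `√(f₀² - u²)`, and `r = f₀ - u²/κ` lies below that because `|u| ≤ κ ≤ f₀`.
  -- The loss of mass is only `∫ u² / κ`.
  refine ⟨fun x => perturbed f₀ u σ x - boolSign (σ i) * u i x - u i x ^ 2 / κ, ?_, hnn, ?_, ?_⟩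
  · exact ((h.measurable_perturbed σ).sub ((h.measurable_bump i).const_mul _)).sub
      (((h.measurable_bump i).pow_const 2).div_const κ)
  · intro x
    rw [perturbed_flip]
    by_cases hx : u i x = 0
    · simp [hx, sq]
    · have h0 := on x hx
      have h1 := h.le_base i x hx
      have h2 := h.abs_bump_le i x
      have h3 : perturbed f₀ u σ x = f₀ x + boolSign (σ i) * u i x := by linarith
      simp only [h3]
      have h4 : (f₀ x + boolSign (σ i) * u i x) *
          (f₀ x + boolSign (σ i) * u i x - 2 * (boolSign (σ i) * u i x)) =
          f₀ x ^ 2 - u i x ^ 2 := by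
        linear_combination (-(u i x) ^ 2) * boolSign_sq (σ i)
      rw [h4]
      set w := u i x ^ 2 / κ with hw
      have hw0 : 0 ≤ w := by positivity
      have hwκ : w * κ = u i x ^ 2 := by rw [hw]; field_simp
      have hwle : w ≤ κ := by
        rw [hw, div_le_iff₀ hκ, ← sq_abs]; nlinarith [abs_nonneg (u i x)]
      have : f₀ x + boolSign (σ i) * u i x - boolSign (σ i) * u i x - w = f₀ x - w := by ring
      rw [this, ← hwκ]
      -- The claim amounts to `w (κ + w) ≤ 2 w f₀`, which holds since `w ≤ κ ≤ f₀`.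
      nlinarith [mul_le_mul_of_nonneg_left h1 hw0, mul_le_mul_of_nonneg_left hwle hw0]
  · have hint' : Integrable
        fun x => perturbed f₀ u σ x - boolSign (σ i) * u i x - u i x ^ 2 / κ :=
      hint.sub (hi2.div_const κ)
    rw [← ofReal_integral_eq_lintegral_ofReal hint'
      (Filter.Eventually.of_forall hnn)]
    refine ENNReal.ofReal_le_ofReal ?_
    rw [integral_sub hint (hi2.div_const κ), integral_sub (h.integrable_perturbed σ)
      ((h.integrable_bump i).const_mul _), h.integral_perturbed, integral_const_mul,
      h.integral_bump, integral_div]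
    have : (∫ x, u i x ^ 2) / κ ≤ 1 / (2 * N) := by
      rw [div_le_iff₀ hκ]
      exact (hu i).trans (le_of_eq (by ring))
    linarith

/-- The part of the risk incurred on the support of the `i`-th bump. -/
def localRisk {N : ℕ} (fhat : Estimator d N) (f₀ : Space d → ℝ) (u : ι → Space d → ℝ) (i : ι)
    (σ : ι → Bool) : ℝ≥0∞ :=
  ∫⁻ X : Fin N → Space d, (∫⁻ x in {x | u i x ≠ 0},
    ENNReal.ofReal |fhat.toFun X x - perturbed f₀ u σ x|)
    ∂(Measure.pi fun _ : Fin N => law (perturbed f₀ u σ))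

theorem measurable_loss {N : ℕ} (fhat : Estimator d N) {f : Space d → ℝ} (hf : Measurable f) :
    Measurable (Function.uncurry fun (X : Fin N → Space d) (x : Space d) =>
      ENNReal.ofReal |fhat.toFun X x - f x|) :=
  ENNReal.measurable_ofReal.comp
    (measurable_norm.comp (fhat.measurable_uncurry.sub (hf.comp measurable_snd)))

theorem measurable_setLIntegral_loss {N : ℕ} (fhat : Estimator d N) {f : Space d → ℝ}
    (hf : Measurable f) (s : Set (Space d)) :
    Measurable fun X : Fin N → Space d =>
      ∫⁻ x in s, ENNReal.ofReal |fhat.toFun X x - f x| :=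
  (measurable_loss fhat hf).lintegral_prod_right'

theorem sum_localRisk_le (h : IsBumpFamily κ f₀ u) {N : ℕ} (fhat : Estimator d N)
    (σ : ι → Bool) :
    ∑ i, localRisk fhat f₀ u i σ ≤ l1Risk fhat (perturbed f₀ u σ) := by
  unfold localRisk l1Risk
  rw [← lintegral_finsetSum _ fun i _ =>
    measurable_setLIntegral_loss fhat (h.measurable_perturbed σ) _]
  refine lintegral_mono fun X => ?_
  rw [← lintegral_biUnion_finset ?_ fun i _ => h.measurableSet_bump i]
  · exact setLIntegral_le_lintegral _ _
  · intro i _ j _ hij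
    exact Set.disjoint_left.mpr fun x hx hx' => hx' (h.disjoint i j x hij hx)

/-- Passing to the fixed reference measure lets risks under different sign vectors be compared
inside one integral. -/
theorem localRisk_eq (h : IsBumpFamily κ f₀ u) {N : ℕ} (fhat : Estimator d N) (i : ι)
    (σ : ι → Bool) :
    localRisk fhat f₀ u i σ = ∫⁻ X : Fin N → Space d,
      (∏ j, ENNReal.ofReal (perturbed f₀ u σ (X j))) * (∫⁻ x in {x | u i x ≠ 0},
        ENNReal.ofReal |fhat.toFun X x - perturbed f₀ u σ x|)
      ∂(Measure.pi fun _ : Fin N => (volume : Measure (Space d))) := by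
  have hm : Measurable fun x => ENNReal.ofReal (perturbed f₀ u σ x) :=
    ENNReal.measurable_ofReal.comp (h.measurable_perturbed σ)
  have : IsProbabilityMeasure
      ((volume : Measure (Space d)).withDensity fun x => ENNReal.ofReal (perturbed f₀ u σ x)) :=
    ⟨by rw [withDensity_apply _ MeasurableSet.univ, setLIntegral_univ, h.lintegral_perturbed]⟩
  have hprod : Measurable fun X : Fin N → Space d =>
      ∏ j, ENNReal.ofReal (perturbed f₀ u σ (X j)) :=
    Finset.measurable_prod _ fun j _ => hm.comp (measurable_pi_apply j)
  unfold localRisk law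
  rw [pi_withDensity _ hm, lintegral_withDensity_eq_lintegral_mul _ hprod
    (measurable_setLIntegral_loss fhat (h.measurable_perturbed σ) _)]
  rfl

/-- Le Cam's two-point argument: on the support of `u i` the two densities differ by `2 |u i|`, so
by the triangle inequality the two losses add up to at least `2 ∫ |u i|` for every sample. Replacing
both weights by their minimum leaves the affinity, at least 1/8, as a factor. -/
theorem localRisk_add_flip_ge [DecidableEq ι] (h : IsBumpFamily κ f₀ u) {N : ℕ} (hN : 1 ≤ N)
    (hu : ∀ i, (∫ x, u i x ^ 2) ≤ κ / (2 * N)) (fhat : Estimator d N) (i : ι) (σ : ι → Bool) :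
    1 / 8 * (2 * ∫⁻ x, ENNReal.ofReal |u i x|) ≤
      localRisk fhat f₀ u i σ + localRisk fhat f₀ u i (flip i σ) := by
  obtain ⟨r, hrm, hr0, hr2, hr1⟩ := h.exists_sq_le_mul hu i σ
  have aff := affinity_pi_ge volume hN (h.measurable_perturbed σ)
    (h.measurable_perturbed (flip i σ)) hrm (h.perturbed_nonneg σ) (h.perturbed_nonneg (flip i σ))
    hr0 hr2 (h.lintegral_perturbed σ) (h.lintegral_perturbed (flip i σ)) hr1
  have meas : ∀ τ : ι → Bool,
      Measurable fun X : Fin N → Space d => ∏ j, ENNReal.ofReal (perturbed f₀ u τ (X j)) :=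
    fun τ => Finset.measurable_prod _ fun j _ =>
      (ENNReal.measurable_ofReal.comp (h.measurable_perturbed τ)).comp (measurable_pi_apply j)
  have gap : ∀ X : Fin N → Space d, 2 * ∫⁻ x, ENNReal.ofReal |u i x| ≤
      (∫⁻ x in {x | u i x ≠ 0}, ENNReal.ofReal |fhat.toFun X x - perturbed f₀ u σ x|) +
      ∫⁻ x in {x | u i x ≠ 0}, ENNReal.ofReal |fhat.toFun X x - perturbed f₀ u (flip i σ) x| := by
    intro X
    have hmX : ∀ τ : ι → Bool,
        Measurable fun x => ENNReal.ofReal |fhat.toFun X x - perturbed f₀ u τ x| := fun τ =>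
      (measurable_loss fhat (h.measurable_perturbed τ)).comp measurable_prodMk_left
    have hmu : Measurable fun x => ENNReal.ofReal |u i x| :=
      ENNReal.measurable_ofReal.comp (measurable_norm.comp (h.measurable_bump i))
    rw [← lintegral_add_left (hmX σ), ← lintegral_const_mul _ hmu,
      ← lintegral_indicator (h.measurableSet_bump i)]
    refine lintegral_mono fun x => ?_
    by_cases hx : u i x = 0
    · simp [hx]
    · rw [Set.indicator_of_mem (show x ∈ {x | u i x ≠ 0} from hx),
        ← ENNReal.ofReal_add (abs_nonneg _) (abs_nonneg _), perturbed_flip,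
        show (2 : ℝ≥0∞) = ENNReal.ofReal 2 by norm_num, ← ENNReal.ofReal_mul (by norm_num)]
      refine ENNReal.ofReal_le_ofReal ?_
      have h1 : 2 * |u i x| = |2 * (boolSign (σ i) * u i x)| := by
        rw [abs_mul, abs_mul, abs_boolSign, one_mul, abs_of_pos (by norm_num : (0 : ℝ) < 2)]
      rw [h1]
      refine le_trans (le_of_eq ?_) ((abs_sub _ _).trans (le_of_eq (add_comm _ _)))
      congr 1
      ring
  have hmul : Measurable fun X : Fin N → Space d =>
      (∏ j, ENNReal.ofReal (perturbed f₀ u σ (X j))) * ∫⁻ x in {x | u i x ≠ 0},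
        ENNReal.ofReal |fhat.toFun X x - perturbed f₀ u σ x| :=
    (meas σ).mul (measurable_setLIntegral_loss fhat (h.measurable_perturbed σ) _)
  rw [h.localRisk_eq, h.localRisk_eq, ← lintegral_add_left hmul]
  calc _ ≤ (∫⁻ X : Fin N → Space d, min (∏ j, ENNReal.ofReal (perturbed f₀ u σ (X j)))
            (∏ j, ENNReal.ofReal (perturbed f₀ u (flip i σ) (X j)))
            ∂(Measure.pi fun _ => volume)) * (2 * ∫⁻ x, ENNReal.ofReal |u i x|) := by
        gcongr
    _ = ∫⁻ X : Fin N → Space d, min (∏ j, ENNReal.ofReal (perturbed f₀ u σ (X j)))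
            (∏ j, ENNReal.ofReal (perturbed f₀ u (flip i σ) (X j))) *
            (2 * ∫⁻ x, ENNReal.ofReal |u i x|) ∂(Measure.pi fun _ => volume) :=
        (lintegral_mul_const _ ((meas σ).min (meas (flip i σ)))).symm
    _ ≤ _ := by
        refine lintegral_mono fun X => ?_
        refine (mul_le_mul_right (gap X) _).trans ?_
        rw [mul_add]
        gcongr
        · exact min_le_left _ _
        · exact min_le_right _ _

/-- **Assouad's lemma** for the `ℓ₁` risk. -/
theorem exists_l1Risk_ge (h : IsBumpFamily κ f₀ u) {N : ℕ} (hN : 1 ≤ N)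
    (hu : ∀ i, (∫ x, u i x ^ 2) ≤ κ / (2 * N)) (fhat : Estimator d N) :
    ∃ σ : ι → Bool, 1 / 8 * ∑ i, ∫⁻ x, ENNReal.ofReal |u i x| ≤
      l1Risk fhat (perturbed f₀ u σ) := by
  classical
  by_contra! hlt
  -- Average over all sign vectors: flipping the `i`-th sign permutes them, so pairing each `σ` with
  -- its flip counts every local risk twice.
  have h1 : ∀ i, ∑ σ : ι → Bool, 1 / 8 * (2 * ∫⁻ x, ENNReal.ofReal |u i x|) ≤
      2 * ∑ σ, localRisk fhat f₀ u i σ := fun i => by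
    have e : ∑ σ, localRisk fhat f₀ u i (flip i σ) = ∑ σ, localRisk fhat f₀ u i σ :=
      Equiv.sum_comp (flip_involutive i).toPerm (localRisk fhat f₀ u i)
    rw [two_mul (∑ σ, localRisk fhat f₀ u i σ)]
    nth_rewrite 2 [← e]
    rw [← Finset.sum_add_distrib]
    exact Finset.sum_le_sum fun σ _ => h.localRisk_add_flip_ge hN hu fhat i σ
  have h2 : 2 * ∑ σ : ι → Bool, 1 / 8 * ∑ i, ∫⁻ x, ENNReal.ofReal |u i x| ≤
      2 * ∑ σ, l1Risk fhat (perturbed f₀ u σ) := by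
    calc _ = ∑ i, ∑ σ : ι → Bool, 1 / 8 * (2 * ∫⁻ x, ENNReal.ofReal |u i x|) := by
          simp only [Finset.sum_const, nsmul_eq_mul, Finset.mul_sum]
          exact Finset.sum_congr rfl fun i _ => by ring
      _ ≤ ∑ i, 2 * ∑ σ, localRisk fhat f₀ u i σ := Finset.sum_le_sum fun i _ => h1 i
      _ = 2 * ∑ σ, ∑ i, localRisk fhat f₀ u i σ := by
          rw [← Finset.mul_sum, Finset.sum_comm]
      _ ≤ _ := by
          gcongr with σ
          exact h.sum_localRisk_le fhat σ
  have h3 := (ENNReal.mul_le_mul_iff_right (by norm_num) (by norm_num)).mp h2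
  exact absurd h3 (not_le.mpr (ENNReal.sum_lt_sum_of_nonempty Finset.univ_nonempty
    fun σ _ => hlt σ))

end IsBumpFamily

/-! ### The decay bound, and derivatives in place of gradients. -/

theorem decayBound_eq (C y : ℝ) : decayBound C y = C * (y * (1 - Real.log y)) := by
  unfold decayBound
  rw [one_div, Real.log_inv]
  ring

/-- That `y (1 - log y)` increases on `[0, 1]` follows from `log (y / x) ≤ y / x - 1` together with
`log y ≤ 0`, without differentiating. -/
theorem decayBound_mono {C x y : ℝ} (hC : 0 ≤ C) (hx : 0 ≤ x) (hxy : x ≤ y) (hy : y ≤ 1) :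
    decayBound C x ≤ decayBound C y := by
  rw [decayBound_eq, decayBound_eq]
  refine mul_le_mul_of_nonneg_left ?_ hC
  have hlogy : Real.log y ≤ 0 := Real.log_nonpos (hx.trans hxy) hy
  rcases hx.eq_or_lt with rfl | hx
  · rw [zero_mul]; exact mul_nonneg hxy (by linarith)
  · have hy0 : 0 < y := hx.trans_le hxy
    have h := Real.log_le_sub_one_of_pos (div_pos hy0 hx)
    rw [Real.log_div hy0.ne' hx.ne'] at h
    have h1 : x * (Real.log y - Real.log x) ≤ y - x := by
      calc _ ≤ x * (y / x - 1) := mul_le_mul_of_nonneg_left h hx.le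
        _ = y - x := by field_simp
    nlinarith [mul_nonneg (sub_nonneg.mpr hxy) (neg_nonneg.mpr hlogy)]

theorem mul_le_decayBound {C y : ℝ} (hC : 0 ≤ C) (hy : 0 ≤ y) (hy1 : y ≤ 1) :
    C * y ≤ decayBound C y := by
  rw [decayBound_eq]
  refine mul_le_mul_of_nonneg_left ?_ hC
  nlinarith [Real.log_nonpos hy hy1]

/-- The logarithmic factor only grows when `y` is halved. This serves for perturbations that may
halve the density. -/
theorem decayBound_le_two_mul_half {C y : ℝ} (hC : 0 ≤ C) (hy : 0 ≤ y) :
    decayBound C y ≤ 2 * decayBound C (y / 2) := by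
  rcases hy.eq_or_lt with rfl | hy
  · simp [decayBound]
  · rw [decayBound_eq, decayBound_eq, Real.log_div hy.ne' (by norm_num)]
    nlinarith [mul_nonneg (mul_nonneg hC hy.le) (Real.log_pos one_lt_two).le]

theorem decayBound_mul (a C y : ℝ) : decayBound (a * C) y = a * decayBound C y := by
  unfold decayBound; ring

theorem norm_gradient_eq {d : ℕ} (f : Space d → ℝ) (x : Space d) :
    ‖gradient f x‖ = ‖fderiv ℝ f x‖ := by
  unfold gradient
  exact LinearIsometryEquiv.norm_map _ _

/-- The inverse of the Riesz map as a linear isometry. -/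
def rieszSymm (d : ℕ) : (Space d →L[ℝ] ℝ) →ₗᵢ[ℝ] Space d where
  toFun := (InnerProductSpace.toDual ℝ (Space d)).symm
  map_add' := map_add _
  map_smul' c φ := by
    rw [LinearIsometryEquiv.map_smulₛₗ]
    simp
  norm_map' φ := LinearIsometryEquiv.norm_map _ _

/-- The gradient is the derivative followed by the Riesz isometry, and composing with a linear
isometry on the left preserves the operator norm. -/
theorem norm_fderiv_gradient_eq {d : ℕ} {f : Space d → ℝ} (hf : ContDiff ℝ 2 f) (x : Space d) :
    ‖fderiv ℝ (gradient f) x‖ = ‖fderiv ℝ (fderiv ℝ f) x‖ := by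
  have hd : DifferentiableAt ℝ (fderiv ℝ f) x :=
    ((hf.fderiv_right (m := 1) (by norm_num)).differentiable (by norm_num)) x
  have h : HasFDerivAt (gradient f)
      ((rieszSymm d).toContinuousLinearMap.comp (fderiv ℝ (fderiv ℝ f) x)) x :=
    (rieszSymm d).toContinuousLinearMap.hasFDerivAt.comp x hd.hasFDerivAt
  rw [h.fderiv]
  exact LinearIsometry.norm_toContinuousLinearMap_comp _

/-! ### Stability of the class conditions under sums and small perturbations. -/

/-- The regularity and tail conditions of `IsSmoothTailDensity`, without the normalization. -/
structure TailProfile {d : ℕ} (β B D : ℝ) (f : Space d → ℝ) : Prop where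
  nonneg : ∀ x, 0 ≤ f x
  contDiff : ContDiff ℝ 2 f
  le_one : ∀ x, f x ≤ 1
  norm_fderiv_le : ∀ x, ‖fderiv ℝ f x‖ ≤ decayBound B (f x)
  norm_fderiv_fderiv_le : ∀ x, ‖fderiv ℝ (fderiv ℝ f) x‖ ≤ decayBound B (f x)
  tail_le : ∀ t : ℝ, 0 < t →
    ∫⁻ x in {x | f x < t}, ENNReal.ofReal (f x) ≤ ENNReal.ofReal (D * t ^ β)

theorem differentiable_fderiv {d : ℕ} {f : Space d → ℝ} (hf : ContDiff ℝ 2 f) :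
    Differentiable ℝ (fderiv ℝ f) :=
  (hf.fderiv_right (m := 1) (by norm_num)).differentiable (by norm_num)

theorem fderiv_fderiv_add {d : ℕ} {f g : Space d → ℝ} (hf : ContDiff ℝ 2 f)
    (hg : ContDiff ℝ 2 g) (x : Space d) :
    fderiv ℝ (fderiv ℝ (fun x => f x + g x)) x =
      fderiv ℝ (fderiv ℝ f) x + fderiv ℝ (fderiv ℝ g) x := by
  have h : fderiv ℝ (fun x => f x + g x) = fun x => fderiv ℝ f x + fderiv ℝ g x := by
    ext1 y
    exact fderiv_fun_add (hf.differentiable (by norm_num) y) (hg.differentiable (by norm_num) y)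
  rw [h]
  exact fderiv_fun_add (differentiable_fderiv hf x) (differentiable_fderiv hg x)

namespace TailProfile

variable {d : ℕ} {β B D : ℝ} {f g w : Space d → ℝ}

theorem measurable (hf : TailProfile β B D f) : Measurable f :=
  hf.contDiff.continuous.measurable

theorem isSmoothTailDensity (hf : TailProfile β B D f) (h1 : ∫⁻ x, ENNReal.ofReal (f x) = 1)
    {Cb Cc Cd : ℝ} (hb : B ≤ Cb) (hc : B ≤ Cc) (hd : D ≤ Cd) :
    IsSmoothTailDensity β Cb Cc Cd f := by
  have mono : ∀ {C x}, B ≤ C → decayBound B (f x) ≤ decayBound C (f x) := fun {C x} hC => by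
    rw [decayBound_eq, decayBound_eq]
    refine mul_le_mul_of_nonneg_right hC (mul_nonneg (hf.nonneg x) ?_)
    linarith [Real.log_nonpos (hf.nonneg x) (hf.le_one x)]
  refine ⟨hf.nonneg, h1, hf.contDiff, hf.le_one, fun x => ?_, fun x => ?_, fun t ht => ?_⟩
  · rw [norm_gradient_eq]
    exact (hf.norm_fderiv_le x).trans (mono hb)
  · rw [norm_fderiv_gradient_eq hf.contDiff]
    exact (hf.norm_fderiv_fderiv_le x).trans (mono hc)
  · rw [law, withDensity_apply _ (measurableSet_lt hf.measurable measurable_const)]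
    refine (hf.tail_le t ht).trans (ENNReal.ofReal_le_ofReal ?_)
    exact mul_le_mul_of_nonneg_right hd (Real.rpow_nonneg ht.le _)

/-- Monotonicity of the decay bound allows each summand's bound to be evaluated at `f + g`, which
costs a factor 2. For the tails, `f + g < t` forces both `f < t` and `g < t`. -/
theorem add (hB : 0 ≤ B) (hD : 0 ≤ D) (hf : TailProfile β B D f) (hg : TailProfile β B D g)
    (h1 : ∀ x, f x + g x ≤ 1) : TailProfile β (2 * B) (2 * D) fun x => f x + g x := by
  have hdf : ∀ x, decayBound B (f x) + decayBound B (g x) ≤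
      decayBound (2 * B) (f x + g x) := fun x => by
    rw [decayBound_mul]
    have h2 := decayBound_mono hB (hf.nonneg x) (le_add_of_nonneg_right (hg.nonneg x)) (h1 x)
    have h3 := decayBound_mono hB (hg.nonneg x) (le_add_of_nonneg_left (hf.nonneg x)) (h1 x)
    linarith
  refine ⟨fun x => add_nonneg (hf.nonneg x) (hg.nonneg x), hf.contDiff.add hg.contDiff, h1,
    fun x => ?_, fun x => ?_, fun t ht => ?_⟩
  · rw [fderiv_fun_add (hf.contDiff.differentiable (by norm_num) x)
      (hg.contDiff.differentiable (by norm_num) x)]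
    exact (norm_add_le _ _).trans
      ((add_le_add (hf.norm_fderiv_le x) (hg.norm_fderiv_le x)).trans (hdf x))
  · rw [fderiv_fderiv_add hf.contDiff hg.contDiff]
    exact (norm_add_le (fderiv ℝ (fderiv ℝ f) x) _).trans
      ((add_le_add (hf.norm_fderiv_fderiv_le x) (hg.norm_fderiv_fderiv_le x)).trans (hdf x))
  · have hm : Measurable fun x => ENNReal.ofReal (f x) :=
      ENNReal.measurable_ofReal.comp hf.measurable
    calc ∫⁻ x in {x | f x + g x < t}, ENNReal.ofReal (f x + g x)
        = ∫⁻ x in {x | f x + g x < t}, (ENNReal.ofReal (f x) + ENNReal.ofReal (g x)) :=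
          lintegral_congr fun x => ENNReal.ofReal_add (hf.nonneg x) (hg.nonneg x)
      _ = (∫⁻ x in {x | f x + g x < t}, ENNReal.ofReal (f x)) +
            ∫⁻ x in {x | f x + g x < t}, ENNReal.ofReal (g x) := lintegral_add_left hm _
      _ ≤ (∫⁻ x in {x | f x < t}, ENNReal.ofReal (f x)) +
            ∫⁻ x in {x | g x < t}, ENNReal.ofReal (g x) := by
          refine add_le_add (lintegral_mono_set fun x hx => ?_)
            (lintegral_mono_set fun x hx => ?_)
          · exact lt_of_le_of_lt (le_add_of_nonneg_right (hg.nonneg x)) hx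
          · exact lt_of_le_of_lt (le_add_of_nonneg_left (hf.nonneg x)) hx
      _ ≤ ENNReal.ofReal (D * t ^ β) + ENNReal.ofReal (D * t ^ β) :=
          add_le_add (hf.tail_le t ht) (hg.tail_le t ht)
      _ = ENNReal.ofReal (2 * D * t ^ β) := by
          have : 0 ≤ D * t ^ β := mul_nonneg hD (Real.rpow_nonneg ht.le _)
          rw [← ENNReal.ofReal_add this this]
          congr 1
          ring

/-- Since `|w| ≤ f / 2`, the new density stays between `f / 2` and `2 f`. Derivatives of size `M f`
are absorbed because `y ≤ y (1 + log (1 / y))` for `y ≤ 1`. In the tail one factor 2 comes from `f +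
w ≤ 2 f`, the other from `(2 t) ^ β ≤ 2 t ^ β`. -/
theorem add_perturbation (hβ : β ≤ 1) (hB : 0 ≤ B) (hD : 0 ≤ D) (hf : TailProfile β B D f)
    (hw : ContDiff ℝ 2 w) {M : ℝ} (hM : 0 ≤ M) (hle : ∀ x, |w x| ≤ f x / 2)
    (h1 : ∀ x, f x + w x ≤ 1) (hw1 : ∀ x, ‖fderiv ℝ w x‖ ≤ M * f x)
    (hw2 : ∀ x, ‖fderiv ℝ (fderiv ℝ w) x‖ ≤ M * f x) :
    TailProfile β (2 * (B + M)) (4 * D) fun x => f x + w x := by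
  have hlow : ∀ x, f x / 2 ≤ f x + w x := fun x => by
    have := (abs_le.mp (hle x)).1
    linarith
  have hdf : ∀ x, decayBound B (f x) + M * f x ≤ decayBound (2 * (B + M)) (f x + w x) :=
    fun x => by
    have h0 := hf.nonneg x
    have hBM : 0 ≤ B + M := add_nonneg hB hM
    calc decayBound B (f x) + M * f x
        ≤ decayBound B (f x) + decayBound M (f x) := by
          gcongr
          exact mul_le_decayBound hM h0 (hf.le_one x)
      _ = decayBound (B + M) (f x) := by unfold decayBound; ring
      _ ≤ 2 * decayBound (B + M) (f x / 2) := decayBound_le_two_mul_half hBM h0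
      _ ≤ 2 * decayBound (B + M) (f x + w x) := by
          gcongr
          exact decayBound_mono hBM (by positivity) (hlow x) (h1 x)
      _ = _ := (decayBound_mul _ _ _).symm
  refine ⟨fun x => (div_nonneg (hf.nonneg x) (by norm_num)).trans (hlow x), hf.contDiff.add hw, h1,
    fun x => ?_, fun x => ?_, fun t ht => ?_⟩
  · rw [fderiv_fun_add (hf.contDiff.differentiable (by norm_num) x)
      (hw.differentiable (by norm_num) x)]
    exact (norm_add_le _ _).trans ((add_le_add (hf.norm_fderiv_le x) (hw1 x)).trans (hdf x))
  · rw [fderiv_fderiv_add hf.contDiff hw]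
    exact (norm_add_le (fderiv ℝ (fderiv ℝ f) x) _).trans
      ((add_le_add (hf.norm_fderiv_fderiv_le x) (hw2 x)).trans (hdf x))
  · have hm : Measurable fun x => ENNReal.ofReal (f x) :=
      ENNReal.measurable_ofReal.comp hf.measurable
    calc ∫⁻ x in {x | f x + w x < t}, ENNReal.ofReal (f x + w x)
        ≤ ∫⁻ x in {x | f x + w x < t}, 2 * ENNReal.ofReal (f x) := by
          refine lintegral_mono fun x => ?_
          rw [show (2 : ℝ≥0∞) = ENNReal.ofReal 2 by norm_num,
            ← ENNReal.ofReal_mul (by norm_num)]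
          refine ENNReal.ofReal_le_ofReal ?_
          have := (abs_le.mp (hle x)).2
          linarith [hf.nonneg x]
      _ = 2 * ∫⁻ x in {x | f x + w x < t}, ENNReal.ofReal (f x) := lintegral_const_mul _ hm
      _ ≤ 2 * ∫⁻ x in {x | f x < 2 * t}, ENNReal.ofReal (f x) := by
          refine mul_le_mul_right (lintegral_mono_set fun x hx => ?_) _
          have h2 := hlow x
          have h3 : f x + w x < t := hx
          show f x < 2 * t
          linarith
      _ ≤ 2 * ENNReal.ofReal (D * (2 * t) ^ β) := by
          gcongr
          exact hf.tail_le _ (by linarith)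
      _ ≤ ENNReal.ofReal (4 * D * t ^ β) := by
          rw [show (2 : ℝ≥0∞) = ENNReal.ofReal 2 by norm_num,
            ← ENNReal.ofReal_mul (by norm_num), Real.mul_rpow (by norm_num) ht.le]
          refine ENNReal.ofReal_le_ofReal ?_
          have h2 : (2 : ℝ) ^ β ≤ 2 := by
            calc (2 : ℝ) ^ β ≤ 2 ^ (1 : ℝ) :=
                  Real.rpow_le_rpow_of_exponent_le (by norm_num) hβ
              _ = 2 := Real.rpow_one 2
          have h3 : 0 ≤ D * t ^ β := mul_nonneg hD (Real.rpow_nonneg ht.le _)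
          nlinarith [mul_le_mul_of_nonneg_right h2 h3]

end TailProfile

/-! ### Gaussian profiles: derivatives, mass and tails. -/

theorem lintegral_comp_inv_smul {d : ℕ} {L : ℝ} (hL : 0 < L) {F : Space d → ℝ≥0∞}
    (hF : Measurable F) :
    ∫⁻ x, F (L⁻¹ • x) = ENNReal.ofReal (L ^ d) * ∫⁻ x, F x := by
  have h := Measure.map_addHaar_smul (volume : Measure (Space d)) (inv_ne_zero hL.ne')
  rw [← lintegral_map hF (measurable_const_smul L⁻¹), h, lintegral_smul_measure]
  simp [abs_of_pos hL]

/-- The Gaussian profile of height `A` and width `L`. -/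
def gaussian {d : ℕ} (A L : ℝ) (x : Space d) : ℝ := A * Real.exp (-‖L⁻¹ • x‖ ^ 2)

theorem gaussian_eq {d : ℕ} (A L : ℝ) (x : Space d) :
    gaussian A L x = A * Real.exp (-(L⁻¹ ^ 2 * ‖x‖ ^ 2)) := by
  unfold gaussian
  rw [norm_smul, mul_pow, Real.norm_eq_abs, sq_abs]

theorem gaussian_nonneg {d : ℕ} {A : ℝ} (hA : 0 ≤ A) (L : ℝ) (x : Space d) :
    0 ≤ gaussian A L x :=
  mul_nonneg hA (Real.exp_nonneg _)

theorem gaussian_le {d : ℕ} {A : ℝ} (hA : 0 ≤ A) (L : ℝ) (x : Space d) :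
    gaussian A L x ≤ A :=
  mul_le_of_le_one_right hA (Real.exp_le_one_iff.mpr (by simp))

theorem contDiff_gaussian {d : ℕ} (A L : ℝ) :
    ContDiff ℝ 2 (gaussian A L : Space d → ℝ) := by
  unfold gaussian
  exact contDiff_const.mul (((contDiff_const_smul L⁻¹).norm_sq ℝ).neg.exp)

theorem fderiv_gaussian {d : ℕ} (A L : ℝ) :
    fderiv ℝ (gaussian A L : Space d → ℝ) =
      fun x => (-(2 * L⁻¹ ^ 2) * gaussian A L x) • innerSL ℝ x := by
  ext1 x
  have h1 : HasFDerivAt (fun y : Space d => -(L⁻¹ ^ 2 * ‖y‖ ^ 2))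
      (-(L⁻¹ ^ 2 • (2 • innerSL ℝ x))) x :=
    ((hasStrictFDerivAt_norm_sq x).hasFDerivAt.const_mul (L⁻¹ ^ 2)).neg
  have h2 := (h1.exp).const_mul A
  have h3 : (gaussian A L : Space d → ℝ) =
      fun y => A * Real.exp (-(L⁻¹ ^ 2 * ‖y‖ ^ 2)) := funext fun y => gaussian_eq A L y
  rw [h3, h2.fderiv]
  ext y
  simp
  ring

theorem norm_fderiv_gaussian {d : ℕ} {A : ℝ} (hA : 0 ≤ A) (L : ℝ) (x : Space d) :
    ‖fderiv ℝ (gaussian A L : Space d → ℝ) x‖ = 2 * L⁻¹ ^ 2 * gaussian A L x * ‖x‖ := by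
  rw [fderiv_gaussian, norm_smul, innerSL_apply_norm, Real.norm_eq_abs, neg_mul, abs_neg,
    abs_of_nonneg (mul_nonneg (by positivity) (gaussian_nonneg hA L x))]

theorem norm_fderiv_fderiv_gaussian_le {d : ℕ} {A : ℝ} (hA : 0 ≤ A) (L : ℝ) (x : Space d) :
    ‖fderiv ℝ (fderiv ℝ (gaussian A L : Space d → ℝ)) x‖ ≤
      2 * L⁻¹ ^ 2 * gaussian A L x * (1 + 2 * (L⁻¹ ^ 2 * ‖x‖ ^ 2)) := by
  have hg := gaussian_nonneg hA L x
  -- `innerSL ℝ` is typed as conjugate-linear; `I` is the same map seen as real-linear, so that the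
  -- product rule applies.
  obtain ⟨I, hI⟩ : ∃ I : Space d →L[ℝ] Space d →L[ℝ] ℝ, ∀ y, I y = innerSL ℝ y :=
    ⟨innerSL ℝ, fun _ => rfl⟩
  have hIx : ∀ y, ‖I y‖ = ‖y‖ := fun y => by rw [hI, innerSL_apply_norm]
  have hI1 : ‖I‖ ≤ 1 := I.opNorm_le_bound zero_le_one fun y => by rw [hIx, one_mul]
  have h1 : HasFDerivAt (fun y : Space d => -(2 * L⁻¹ ^ 2) * gaussian A L y)
      (-(2 * L⁻¹ ^ 2) • fderiv ℝ (gaussian A L : Space d → ℝ) x) x :=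
    (((contDiff_gaussian A L).differentiable (by norm_num)) x).hasFDerivAt.const_mul _
  have h2 : HasFDerivAt (fun y : Space d => (-(2 * L⁻¹ ^ 2) * gaussian A L y) • I y) _ x :=
    h1.smul I.hasFDerivAt
  have h3 : fderiv ℝ (gaussian A L : Space d → ℝ) =
      fun y => (-(2 * L⁻¹ ^ 2) * gaussian A L y) • I y := by
    simp_rw [hI]
    exact fderiv_gaussian A L
  have n1 : ‖(-(2 * L⁻¹ ^ 2) * gaussian A L x) • I‖ ≤ 2 * L⁻¹ ^ 2 * gaussian A L x := by
    refine (ContinuousLinearMap.opNorm_smul_le _ I).trans ?_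
    rw [Real.norm_eq_abs, neg_mul, abs_neg, abs_of_nonneg (mul_nonneg (by positivity) hg)]
    exact mul_le_of_le_one_right (mul_nonneg (by positivity) hg) hI1
  have n2 : ‖(-(2 * L⁻¹ ^ 2) • fderiv ℝ (gaussian A L : Space d → ℝ) x).smulRight (I x)‖ ≤
      2 * L⁻¹ ^ 2 * gaussian A L x * (2 * (L⁻¹ ^ 2 * ‖x‖ ^ 2)) := by
    rw [ContinuousLinearMap.norm_smulRight_apply, norm_smul, norm_fderiv_gaussian hA,
      hIx, Real.norm_eq_abs, abs_neg, abs_of_nonneg (by positivity)]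
    exact le_of_eq (by ring)
  rw [← h3] at h2
  rw [h2.fderiv, mul_add, mul_one]
  exact (norm_add_le (_ • I) _).trans (add_le_add n1 n2)

/-- Minus the logarithm of the Gaussian is `L⁻² ‖x‖² - log A`, and `log A ≤ 0`. So the logarithm in
the decay bound dominates the quadratic factors produced by two derivatives. -/
theorem gaussian_mul_le_decayBound {d : ℕ} {A : ℝ} (hA : 0 < A) (hA1 : A ≤ 1) (L : ℝ)
    (x : Space d) :
    gaussian A L x * (1 + L⁻¹ ^ 2 * ‖x‖ ^ 2) ≤ decayBound 1 (gaussian A L x) := by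
  rw [decayBound_eq, one_mul]
  refine mul_le_mul_of_nonneg_left ?_ (gaussian_nonneg hA.le L x)
  rw [gaussian_eq, Real.log_mul hA.ne' (Real.exp_ne_zero _), Real.log_exp]
  linarith [Real.log_nonpos hA.le hA1]

theorem lintegral_exp_neg_mul_sq_norm (d : ℕ) {b : ℝ} (hb : 0 < b) :
    ∫⁻ x : Space d, ENNReal.ofReal (Real.exp (-b * ‖x‖ ^ 2)) =
      ENNReal.ofReal ((Real.pi / b) ^ ((d : ℝ) / 2)) := by
  have h := GaussianFourier.integral_rexp_neg_mul_sq_norm (V := Space d) hb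
  rw [← ofReal_integral_eq_lintegral_ofReal _
    (Filter.Eventually.of_forall fun x => (Real.exp_pos _).le), h]
  · simp
  -- Integrability comes for free: the Bochner integral of a non-integrable function is zero, and
  -- this one is not.
  · refine not_imp_comm.mp integral_undef ?_
    rw [h]
    positivity

/-- Where `g < t`, one has `g = g ^ β * g ^ (1 - β) ≤ t ^ β * g ^ (1 - β)`, and for `β < 1` the last
factor is again an integrable Gaussian. -/
theorem exists_gaussian_tail_le_of_lt_one (d : ℕ) {β : ℝ} (hβ0 : 0 < β) (hβ1 : β < 1) :
    ∃ D : ℝ, 0 < D ∧ ∀ t : ℝ, 0 < t →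
      ∫⁻ x in {x : Space d | Real.exp (-‖x‖ ^ 2) < t}, ENNReal.ofReal (Real.exp (-‖x‖ ^ 2)) ≤
        ENNReal.ofReal (D * t ^ β) := by
  have hb : 0 < 1 - β := by linarith
  refine ⟨(Real.pi / (1 - β)) ^ ((d : ℝ) / 2), by positivity, fun t ht => ?_⟩
  have hset : MeasurableSet {x : Space d | Real.exp (-‖x‖ ^ 2) < t} :=
    measurableSet_lt (by fun_prop) measurable_const
  calc _ ≤ ∫⁻ x in {x : Space d | Real.exp (-‖x‖ ^ 2) < t},
        ENNReal.ofReal (t ^ β) * ENNReal.ofReal (Real.exp (-(1 - β) * ‖x‖ ^ 2)) := by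
        refine setLIntegral_mono' hset fun x hx => ?_
        rw [← ENNReal.ofReal_mul (by positivity)]
        refine ENNReal.ofReal_le_ofReal ?_
        have h1 : Real.exp (-‖x‖ ^ 2) =
            Real.exp (-‖x‖ ^ 2) ^ β * Real.exp (-(1 - β) * ‖x‖ ^ 2) := by
          rw [← Real.exp_mul, ← Real.exp_add]
          congr 1
          ring
        rw [h1]
        gcongr
        exact le_of_lt hx
    _ ≤ ∫⁻ x : Space d,
        ENNReal.ofReal (t ^ β) * ENNReal.ofReal (Real.exp (-(1 - β) * ‖x‖ ^ 2)) :=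
        setLIntegral_le_lintegral _ _
    _ = _ := by
        rw [lintegral_const_mul' _ _ ENNReal.ofReal_ne_top, lintegral_exp_neg_mul_sq_norm d hb,
          ← ENNReal.ofReal_mul (by positivity), mul_comm]

theorem integral_Ioi_mul_exp_neg_sq (R : ℝ) :
    ∫ y in Set.Ioi R, y * Real.exp (-y ^ 2) = Real.exp (-R ^ 2) / 2 := by
  have hd : ∀ y : ℝ, HasDerivAt (fun y : ℝ => -(Real.exp (-y ^ 2) / 2))
      (y * Real.exp (-y ^ 2)) y := fun y => by
    have := ((((hasDerivAt_id y).pow 2).neg.exp).div_const 2).neg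
    convert! this using 1
    simp
    ring
  have hint : IntegrableOn (fun y : ℝ => y * Real.exp (-y ^ 2)) (Set.Ioi R) := by
    have := (integrable_mul_exp_neg_mul_sq (b := 1) one_pos).integrableOn (s := Set.Ioi R)
    simpa using this
  have ht : Filter.Tendsto (fun y : ℝ => -(Real.exp (-y ^ 2) / 2)) Filter.atTop (nhds (-(0 / 2))) :=
    ((Real.tendsto_exp_neg_atTop_nhds_zero.comp
      (Filter.tendsto_pow_atTop two_ne_zero)).div_const 2).neg
  rw [integral_Ioi_of_hasDerivAt_of_tendsto' (fun y _ => hd y) hint ht]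
  ring

/-- In polar coordinates the tail is a multiple of the integral of `y ^ (d - 1) * exp (-y ^ 2)` over
`y > R`, with `exp (-R ^ 2) = t`. For `d ≤ 2` and `R ≥ 1` the power is at most `y`, and the integral
becomes the explicit `t / 2`. In higher dimension a power of `log (1 / t)` would survive. -/
theorem exists_gaussian_tail_le_of_dim_le_two {d : ℕ} (hd : 1 ≤ d) (hd2 : d ≤ 2) :
    ∃ D : ℝ, 0 < D ∧ ∀ t : ℝ, 0 < t →
      ∫⁻ x in {x : Space d | Real.exp (-‖x‖ ^ 2) < t}, ENNReal.ofReal (Real.exp (-‖x‖ ^ 2)) ≤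
        ENNReal.ofReal (D * t) := by
  have : Nonempty (Fin d) := ⟨⟨0, hd⟩⟩
  set V : ℝ := (volume : Measure (Space d)).real (Metric.ball 0 1) with hV
  have hV0 : 0 ≤ V := measureReal_nonneg
  set K : ℝ := Real.pi ^ ((d : ℝ) / 2) with hK
  have hK0 : 0 < K := by positivity
  refine ⟨K * Real.exp 1 + 2 * V, by positivity, fun t ht => ?_⟩
  -- For `t ≥ exp (-1)` the total mass suffices; otherwise the radius `R` exceeds 1.
  rcases le_or_gt (Real.exp (-1)) t with h1 | h1
  · refine (setLIntegral_le_lintegral _ _).trans ?_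
    have hm := lintegral_exp_neg_mul_sq_norm d one_pos
    simp only [neg_mul, one_mul, div_one] at hm
    rw [hm]
    refine ENNReal.ofReal_le_ofReal ?_
    have h2 : 1 ≤ Real.exp 1 * t := by
      calc (1 : ℝ) = Real.exp 1 * Real.exp (-1) := by rw [← Real.exp_add]; simp
        _ ≤ _ := by gcongr
    nlinarith [mul_le_mul_of_nonneg_left h2 hK0.le, mul_nonneg hV0 ht.le]
  · set R : ℝ := Real.sqrt (-Real.log t) with hR
    have hlog : Real.log t < -1 := by
      rw [← Real.log_exp (-1)]; exact Real.log_lt_log ht h1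
    have hR2 : R ^ 2 = -Real.log t := Real.sq_sqrt (by linarith)
    have hR1 : 1 ≤ R := by
      rw [hR]; exact Real.one_le_sqrt.mpr (by linarith)
    have htR : Real.exp (-R ^ 2) = t := by rw [hR2, neg_neg, Real.exp_log ht]
    set F : ℝ → ℝ := (Set.Ioi R).indicator fun y => Real.exp (-y ^ 2) with hF
    have hsetm : MeasurableSet {x : Space d | Real.exp (-‖x‖ ^ 2) < t} :=
      measurableSet_lt (by fun_prop) measurable_const
    have hFx : ∀ x : Space d, {x : Space d | Real.exp (-‖x‖ ^ 2) < t}.indicator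
        (fun x => ENNReal.ofReal (Real.exp (-‖x‖ ^ 2))) x = ENNReal.ofReal (F ‖x‖) := fun x => by
      have hiff : Real.exp (-‖x‖ ^ 2) < t ↔ R < ‖x‖ := by
        rw [← htR, Real.exp_lt_exp, neg_lt_neg_iff, sq_lt_sq₀ (by linarith) (norm_nonneg x)]
      by_cases hx : R < ‖x‖
      · rw [Set.indicator_of_mem (s := {x : Space d | Real.exp (-‖x‖ ^ 2) < t}) (hiff.mpr hx),
          hF, Set.indicator_of_mem (Set.mem_Ioi.mpr hx)]
      · rw [Set.indicator_of_notMem (s := {x : Space d | Real.exp (-‖x‖ ^ 2) < t})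
          (fun h => hx (hiff.mp h)), hF, Set.indicator_of_notMem (s := Set.Ioi R) (fun h => hx h),
          ENNReal.ofReal_zero]
    have hF0 : ∀ y, 0 ≤ F y := fun y => Set.indicator_nonneg (fun _ _ => (Real.exp_pos _).le) _
    have hint1 : Integrable fun y : ℝ => y * Real.exp (-y ^ 2) := by
      simpa using integrable_mul_exp_neg_mul_sq (b := 1) one_pos
    have hle : ∀ y ∈ Set.Ioi (0 : ℝ), y ^ (Module.finrank ℝ (Space d) - 1) • F y ≤
        (Set.Ioi R).indicator (fun y => y * Real.exp (-y ^ 2)) y := fun y hy => by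
      by_cases hyR : R < y
      · rw [hF, Set.indicator_of_mem (Set.mem_Ioi.mpr hyR),
          Set.indicator_of_mem (Set.mem_Ioi.mpr hyR), smul_eq_mul, finrank_euclideanSpace_fin]
        refine mul_le_mul_of_nonneg_right ?_ (Real.exp_pos _).le
        calc y ^ (d - 1) ≤ y ^ 1 := pow_le_pow_right₀ (by linarith) (by omega)
          _ = y := pow_one y
      · rw [hF, Set.indicator_of_notMem (s := Set.Ioi R) (fun h => hyR h),
          Set.indicator_of_notMem (s := Set.Ioi R) (fun h => hyR h), smul_zero]
    have hintI : IntegrableOn ((Set.Ioi R).indicator fun y => y * Real.exp (-y ^ 2))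
        (Set.Ioi (0 : ℝ)) := (hint1.indicator measurableSet_Ioi).integrableOn
    have hmF : Measurable F := (by fun_prop : Measurable fun y : ℝ =>
      Real.exp (-y ^ 2)).indicator measurableSet_Ioi
    have hintF : IntegrableOn (fun y : ℝ => y ^ (Module.finrank ℝ (Space d) - 1) • F y)
        (Set.Ioi (0 : ℝ)) := by
      refine Integrable.mono' hintI
        ((measurable_id.pow_const _).smul hmF).aestronglyMeasurable ?_
      refine (ae_restrict_mem measurableSet_Ioi).mono fun y hy => ?_
      rw [Real.norm_of_nonneg (smul_nonneg (pow_nonneg (le_of_lt hy) _) (hF0 y))]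
      exact hle y hy
    have hintx : Integrable fun x : Space d => F ‖x‖ :=
      (integrable_fun_norm_addHaar volume).mpr hintF
    rw [← lintegral_indicator hsetm, lintegral_congr hFx,
      ← ofReal_integral_eq_lintegral_ofReal hintx (Filter.Eventually.of_forall fun x => hF0 _),
      integral_fun_norm_addHaar volume F]
    refine ENNReal.ofReal_le_ofReal ?_
    have hI : ∫ y in Set.Ioi (0 : ℝ), y ^ (Module.finrank ℝ (Space d) - 1) • F y ≤ t / 2 := by
      calc _ ≤ ∫ y in Set.Ioi (0 : ℝ), (Set.Ioi R).indicator (fun y => y * Real.exp (-y ^ 2)) y :=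
            setIntegral_mono_on hintF hintI measurableSet_Ioi hle
        _ = ∫ y in Set.Ioi R, y * Real.exp (-y ^ 2) := by
            rw [setIntegral_indicator measurableSet_Ioi]
            congr 2
            ext y
            simp only [Set.mem_inter_iff, Set.mem_Ioi]
            exact ⟨fun h => h.2, fun h => ⟨by linarith, h⟩⟩
        _ = t / 2 := by rw [integral_Ioi_mul_exp_neg_sq, htR]
    have hd' : (d : ℝ) ≤ 2 := by exact_mod_cast hd2
    rw [finrank_euclideanSpace_fin, nsmul_eq_mul, smul_eq_mul, ← hV]
    rw [finrank_euclideanSpace_fin] at hI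
    have hI0 : 0 ≤ ∫ y in Set.Ioi (0 : ℝ), y ^ (d - 1) • F y :=
      setIntegral_nonneg measurableSet_Ioi fun y hy =>
        smul_nonneg (pow_nonneg (le_of_lt hy) _) (hF0 y)
    calc (d : ℝ) * (V * ∫ y in Set.Ioi (0 : ℝ), y ^ (d - 1) • F y)
        ≤ 2 * (V * (t / 2)) := by gcongr
      _ ≤ (K * Real.exp 1 + 2 * V) * t := by
          have : 0 ≤ K * Real.exp 1 * t := by positivity
          nlinarith [mul_nonneg hV0 ht.le]

theorem exists_gaussian_tail_le {d : ℕ} (hd : 1 ≤ d) {β : ℝ} (hβ0 : 0 < β) (hβ1 : β ≤ 1)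
    (hβd : β = 1 → d ≤ 2) :
    ∃ D : ℝ, 0 < D ∧ ∀ t : ℝ, 0 < t →
      ∫⁻ x in {x : Space d | Real.exp (-‖x‖ ^ 2) < t}, ENNReal.ofReal (Real.exp (-‖x‖ ^ 2)) ≤
        ENNReal.ofReal (D * t ^ β) := by
  rcases hβ1.lt_or_eq with h | rfl
  · exact exists_gaussian_tail_le_of_lt_one d hβ0 h
  · simpa using exists_gaussian_tail_le_of_dim_le_two hd (hβd rfl)

theorem lintegral_gaussian {d : ℕ} {A L : ℝ} (hA : 0 ≤ A) (hL : 0 < L) :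
    ∫⁻ x : Space d, ENNReal.ofReal (gaussian A L x) =
      ENNReal.ofReal (A * L ^ d * Real.pi ^ ((d : ℝ) / 2)) := by
  have hm := lintegral_exp_neg_mul_sq_norm d one_pos
  simp only [neg_mul, one_mul, div_one] at hm
  have hF : Measurable fun x : Space d => ENNReal.ofReal (A * Real.exp (-‖x‖ ^ 2)) := by fun_prop
  have h := lintegral_comp_inv_smul hL hF
  unfold gaussian
  rw [h]
  simp_rw [ENNReal.ofReal_mul hA]
  rw [lintegral_const_mul' _ _ ENNReal.ofReal_ne_top, hm, ← ENNReal.ofReal_mul hA,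
    ← ENNReal.ofReal_mul (by positivity)]
  congr 1
  ring

/-- Gaussian profiles satisfy the regularity and tail conditions, uniformly over heights and widths
with `A ^ (1 - β) L ^ d ≤ 1`. -/
theorem exists_tailProfile_gaussian {d : ℕ} (hd : 1 ≤ d) {β : ℝ} (hβ0 : 0 < β) (hβ1 : β ≤ 1)
    (hβd : β = 1 → d ≤ 2) :
    ∃ D : ℝ, 0 < D ∧ ∀ A L : ℝ, 0 < A → A ≤ 1 → 1 ≤ L → A ^ (1 - β) * L ^ d ≤ 1 →
      TailProfile β 4 D (gaussian A L : Space d → ℝ) := by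
  obtain ⟨D, hD, htail⟩ := exists_gaussian_tail_le hd hβ0 hβ1 hβd
  refine ⟨D, hD, fun A L hA hA1 hL hAL => ?_⟩
  have hL0 : 0 < L := by linarith
  have hc : L⁻¹ ^ 2 ≤ 1 := pow_le_one₀ (by positivity) (inv_le_one_of_one_le₀ hL)
  have hc0 : 0 ≤ L⁻¹ ^ 2 := by positivity
  have h4 : ∀ y, decayBound 4 y = 4 * decayBound 1 y := fun y => by
    rw [← decayBound_mul, mul_one]
  refine ⟨gaussian_nonneg hA.le L, contDiff_gaussian A L, fun x => (gaussian_le hA.le L x).trans hA1,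
    fun x => ?_, fun x => ?_, fun t ht => ?_⟩
  · rw [norm_fderiv_gaussian hA.le, h4]
    have h1 := gaussian_mul_le_decayBound hA hA1 L x
    have hg := gaussian_nonneg hA.le L x
    have h2 : 2 * L⁻¹ ^ 2 * ‖x‖ ≤ 4 * (1 + L⁻¹ ^ 2 * ‖x‖ ^ 2) := by
      nlinarith [mul_nonneg hc0 (sq_nonneg (‖x‖ - 1)), mul_nonneg hc0 (sq_nonneg ‖x‖)]
    nlinarith [mul_le_mul_of_nonneg_left h2 hg]
  · rw [h4]
    refine (norm_fderiv_fderiv_gaussian_le hA.le L x).trans ?_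
    have h1 := gaussian_mul_le_decayBound hA hA1 L x
    have hg := gaussian_nonneg hA.le L x
    set s := L⁻¹ ^ 2 * ‖x‖ ^ 2
    have hs : 0 ≤ s := by positivity
    -- The Hessian's coefficient `4 s` is what sets the constant 4 of the profile.
    have h2 : 2 * L⁻¹ ^ 2 * (1 + 2 * s) ≤ 4 * (1 + s) := by
      nlinarith [mul_le_mul_of_nonneg_right hc (by linarith : 0 ≤ 1 + 2 * s)]
    nlinarith [mul_le_mul_of_nonneg_left h2 hg]
  · have hset : MeasurableSet {x : Space d | Real.exp (-‖x‖ ^ 2) < t / A} :=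
      measurableSet_lt (by fun_prop) measurable_const
    have hset' : MeasurableSet {x : Space d | gaussian A L x < t} :=
      measurableSet_lt (contDiff_gaussian A L).continuous.measurable measurable_const
    have hF : Measurable fun x : Space d => {x : Space d | Real.exp (-‖x‖ ^ 2) < t / A}.indicator
        (fun x => ENNReal.ofReal (A * Real.exp (-‖x‖ ^ 2))) x :=
      Measurable.indicator (by fun_prop) hset
    have hcongr : ∀ x : Space d, {x : Space d | gaussian A L x < t}.indicator
        (fun x => ENNReal.ofReal (gaussian A L x)) x =
        {x : Space d | Real.exp (-‖x‖ ^ 2) < t / A}.indicator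
        (fun x => ENNReal.ofReal (A * Real.exp (-‖x‖ ^ 2))) (L⁻¹ • x) := fun x => by
      have hiff : gaussian A L x < t ↔ Real.exp (-‖L⁻¹ • x‖ ^ 2) < t / A := by
        rw [lt_div_iff₀' hA]; rfl
      by_cases hx : gaussian A L x < t
      · rw [Set.indicator_of_mem (show x ∈ {x | gaussian A L x < t} from hx),
          Set.indicator_of_mem (s := {x : Space d | Real.exp (-‖x‖ ^ 2) < t / A}) (hiff.mp hx)]
        rfl
      · rw [Set.indicator_of_notMem (show x ∉ {x | gaussian A L x < t} from hx),
          Set.indicator_of_notMem (s := {x : Space d | Real.exp (-‖x‖ ^ 2) < t / A})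
            (fun h => hx (hiff.mpr h))]
    rw [← lintegral_indicator hset', lintegral_congr hcongr, lintegral_comp_inv_smul hL0 hF,
      lintegral_indicator hset]
    simp_rw [ENNReal.ofReal_mul hA.le]
    rw [lintegral_const_mul' _ _ ENNReal.ofReal_ne_top]
    -- Rescaling multiplies the unit tail bound by `L ^ d * A * A ^ (-β)`, the quantity assumed to
    -- be at most 1.
    calc _ ≤ ENNReal.ofReal (L ^ d) * (ENNReal.ofReal A * ENNReal.ofReal (D * (t / A) ^ β)) := by
          gcongr
          exact htail _ (by positivity)
      _ = ENNReal.ofReal (A ^ (1 - β) * L ^ d * (D * t ^ β)) := by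
          rw [← ENNReal.ofReal_mul hA.le, ← ENNReal.ofReal_mul (by positivity),
            Real.div_rpow ht.le hA.le, Real.rpow_sub hA, Real.rpow_one]
          congr 1
          ring
      _ ≤ ENNReal.ofReal (D * t ^ β) := by
          refine ENNReal.ofReal_le_ofReal (mul_le_of_le_one_left ?_ hAL)
          positivity

/-! ### The base density. -/

/-- A probability density with the required regularity and tails, which is at least of order `v` on
a ball of radius of order `L`, where `v L ^ d = v ^ β`. -/
theorem exists_base_density {d : ℕ} (hd : 1 ≤ d) {β : ℝ} (hβ0 : 0 < β) (hβ1 : β ≤ 1)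
    (hβd : β = 1 → d ≤ 2) :
    ∃ D κ : ℝ, 0 < D ∧ 0 < κ ∧ κ ≤ 1 ∧ ∀ v : ℝ, 0 < v → v ≤ 1 →
      ∃ (L : ℝ) (f : Space d → ℝ), 1 ≤ L ∧ v * L ^ d = v ^ β ∧ TailProfile β 8 D f ∧
        ∫⁻ x, ENNReal.ofReal (f x) = 1 ∧ (∀ x, f x ≤ 2 / 3) ∧
        ∀ x, ‖L⁻¹ • x‖ ≤ Real.sqrt d + 1 → κ * v ≤ f x := by
  obtain ⟨D, hD, hprof⟩ := exists_tailProfile_gaussian hd hβ0 hβ1 hβd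
  set K : ℝ := Real.pi ^ ((d : ℝ) / 2) with hK
  -- The two heights will add up to at most `1 / K ≤ 2 / 3`, which leaves room for a perturbation of
  -- size `f / 2` below the cap 1.
  have hK32 : 3 / 2 ≤ K := by
    have hd' : (1 : ℝ) ≤ d := by exact_mod_cast hd
    calc (3 / 2 : ℝ) ≤ Real.sqrt Real.pi :=
          Real.le_sqrt_of_sq_le (by nlinarith [Real.pi_gt_three])
      _ = Real.pi ^ ((1 : ℝ) / 2) := Real.sqrt_eq_rpow _
      _ ≤ K := Real.rpow_le_rpow_of_exponent_le (by linarith [Real.pi_gt_three]) (by linarith)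
  have hK0 : 0 < K := by linarith
  set q : ℝ := Real.exp (-(Real.sqrt d + 1) ^ 2) with hq
  have hq0 : 0 < q := Real.exp_pos _
  have hq1 : q ≤ 1 := Real.exp_le_one_iff.mpr (by simp [sq_nonneg])
  refine ⟨2 * D, q / (2 * K), by positivity, by positivity, ?_, fun v hv hv1 => ?_⟩
  · rw [div_le_one (by positivity)]; linarith
  have hvβ : v ≤ v ^ β := by
    calc v = v ^ (1 : ℝ) := (Real.rpow_one v).symm
      _ ≤ v ^ β := Real.rpow_le_rpow_of_exponent_ge hv hv1 hβ1
  have hvβ1 : v ^ β ≤ 1 := Real.rpow_le_one hv.le hv1 hβ0.le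
  set L : ℝ := (v ^ (β - 1)) ^ ((d : ℝ)⁻¹) with hL
  have hLd : L ^ d = v ^ (β - 1) := Real.rpow_inv_natCast_pow (by positivity) (by omega)
  have hL1 : 1 ≤ L :=
    Real.one_le_rpow (Real.one_le_rpow_of_pos_of_le_one_of_nonpos hv hv1 (by linarith))
      (by positivity)
  have hL0 : 0 < L := by linarith
  have hvL : v * L ^ d = v ^ β := by
    rw [hLd, ← Real.rpow_one_add' hv.le (by linarith)]
    congr 1
    ring
  -- A Gaussian of height `A` and width `L` has mass `A * L ^ d * K`: the narrow one carries `1 - v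
  -- ^ β / 2`, the wide one `v ^ β / 2`.
  set A₁ : ℝ := (1 - v ^ β / 2) / K with hA₁
  set A₂ : ℝ := v / (2 * K) with hA₂
  have hA₁0 : 0 < A₁ := div_pos (by linarith) hK0
  have hA₂0 : 0 < A₂ := by positivity
  have hsum : A₁ + A₂ ≤ 2 / 3 := by
    have : A₁ + A₂ = (1 - v ^ β / 2 + v / 2) / K := by rw [hA₁, hA₂]; field_simp
    rw [this, div_le_iff₀ hK0]
    linarith
  have hA₂v : A₂ ≤ v := div_le_self hv.le (by linarith)
  have p₁ := hprof A₁ 1 hA₁0 (by linarith) le_rfl (by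
    rw [one_pow, mul_one]
    exact Real.rpow_le_one hA₁0.le (by linarith) (by linarith))
  have p₂ := hprof A₂ L hA₂0 (by linarith) hL1 (by
    rw [hLd]
    calc A₂ ^ (1 - β) * v ^ (β - 1) ≤ v ^ (1 - β) * v ^ (β - 1) := by
          gcongr
      _ = 1 := by rw [← Real.rpow_add hv]; simp)
  have hle : ∀ x : Space d, gaussian A₁ 1 x + gaussian A₂ L x ≤ 2 / 3 := fun x =>
    (add_le_add (gaussian_le hA₁0.le 1 x) (gaussian_le hA₂0.le L x)).trans hsum
  have hprofile := p₁.add (by norm_num) hD.le p₂ fun x => (hle x).trans (by norm_num)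
  refine ⟨L, fun x => gaussian A₁ 1 x + gaussian A₂ L x, hL1, hvL, ?_, ?_, hle, fun x hx => ?_⟩
  · convert hprofile using 1
    norm_num
  · simp_rw [ENNReal.ofReal_add (gaussian_nonneg hA₁0.le 1 _) (gaussian_nonneg hA₂0.le L _)]
    have hm : Measurable fun x : Space d => ENNReal.ofReal (gaussian A₁ 1 x) :=
      ENNReal.measurable_ofReal.comp p₁.measurable
    rw [lintegral_add_left hm,
      lintegral_gaussian hA₁0.le one_pos, lintegral_gaussian hA₂0.le hL0,
      ← ENNReal.ofReal_add (by positivity) (by positivity), ← ENNReal.ofReal_one]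
    congr 1
    rw [← hK, hA₁, hA₂]
    have h2 : v / (2 * K) * L ^ d * K = v * L ^ d / 2 := by field_simp
    rw [h2, hvL]
    field_simp
    ring
  · have h1 : q ≤ Real.exp (-‖L⁻¹ • x‖ ^ 2) := by
      refine Real.exp_le_exp.mpr (neg_le_neg ?_)
      gcongr
    calc q / (2 * K) * v = A₂ * q := by rw [hA₂]; ring
      _ ≤ gaussian A₂ L x := mul_le_mul_of_nonneg_left h1 hA₂0.le
      _ ≤ _ := le_add_of_nonneg_left (gaussian_nonneg hA₁0.le 1 x)

/-! ### A mean-zero bump. -/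

theorem exists_norm_fderiv_le_of_hasCompactSupport {E G : Type*} [NormedAddCommGroup E]
    [NormedSpace ℝ E] [NormedAddCommGroup G] [NormedSpace ℝ G] {ψ : E → G} (hc : ContDiff ℝ 1 ψ) (hcs : HasCompactSupport ψ) :
    ∃ M : ℝ, ∀ x, ‖fderiv ℝ ψ x‖ ≤ M := by
  have hcs1 : HasCompactSupport (fderiv ℝ ψ) := hcs.fderiv ℝ
  have hc1 := hc.continuous_fderiv (by norm_num)
  exact hcs1.exists_bound_of_continuous hc1

theorem exists_norm_fderiv_fderiv_le_of_hasCompactSupport {E : Type*} [NormedAddCommGroup E]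
    [NormedSpace ℝ E] {ψ : E → ℝ} (hc : ContDiff ℝ 2 ψ) (hcs : HasCompactSupport ψ) :
    ∃ M : ℝ, (∀ x, ‖fderiv ℝ ψ x‖ ≤ M) ∧ ∀ x, ‖fderiv ℝ (fderiv ℝ ψ) x‖ ≤ M := by
  have hcs1 : HasCompactSupport (fderiv ℝ ψ) := hcs.fderiv ℝ
  have hc1 : ContDiff ℝ 1 (fderiv ℝ ψ) := hc.fderiv_right (by norm_num)
  have ⟨M₁, h₁⟩ := exists_norm_fderiv_le_of_hasCompactSupport (hc.of_le (by norm_num)) hcs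
  have ⟨M₂, h₂⟩ := exists_norm_fderiv_le_of_hasCompactSupport (G := E →L[ℝ] ℝ) hc1 hcs1
  exact ⟨max M₁ M₂, fun x => (h₁ x).trans (le_max_left _ _),
    fun x => (h₂ x).trans (le_max_right _ _)⟩

/-- A nonzero mean-zero `C ^ 2` function supported in the ball of radius `1 / 2`, with values in
`[-1, 1]` and derivatives bounded by `M`. -/
structure IsMeanZeroBump {d : ℕ} (ψ : Space d → ℝ) (M : ℝ) : Prop where
  contDiff : ContDiff ℝ 2 ψ
  bound_nonneg : 0 ≤ M
  integrable : Integrable ψ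
  integral_eq_zero : ∫ x, ψ x = 0
  integral_abs_pos : 0 < ∫ x, |ψ x|
  abs_le_one : ∀ x, |ψ x| ≤ 1
  norm_fderiv_le : ∀ x, ‖fderiv ℝ ψ x‖ ≤ M
  norm_fderiv_fderiv_le : ∀ x, ‖fderiv ℝ (fderiv ℝ ψ) x‖ ≤ M
  eq_zero : ∀ x, 1 / 2 ≤ ‖x‖ → ψ x = 0 ∧ fderiv ℝ ψ x = 0 ∧ fderiv ℝ (fderiv ℝ ψ) x = 0

/-- A coordinate times an even smooth bump is odd, hence of mean zero. Its closed support lies in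
the ball of radius 1/4, so it vanishes with its derivatives from radius 1/2 on, and inside `|x i| ≤
‖x‖` bounds it by 1. -/
theorem exists_isMeanZeroBump {d : ℕ} (hd : 1 ≤ d) :
    ∃ (ψ : Space d → ℝ) (M : ℝ), IsMeanZeroBump ψ M := by
  let i : Fin d := ⟨0, hd⟩
  obtain ⟨φ, hin, hrout⟩ : ∃ φ : ContDiffBump (0 : Space d), φ.rIn = 1 / 8 ∧ φ.rOut = 1 / 4 :=
    ⟨⟨1 / 8, 1 / 4, by norm_num, by norm_num⟩, rfl, rfl⟩
  obtain ⟨ψ, hψ⟩ : ∃ ψ : Space d → ℝ, ψ = fun x => x i * φ x := ⟨_, rfl⟩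
  have hcoord : ContDiff ℝ 2 fun x : Space d => x i :=
    (EuclideanSpace.proj i : Space d →L[ℝ] ℝ).contDiff
  have hc : ContDiff ℝ 2 ψ := hψ ▸ hcoord.mul φ.contDiff
  have hts : tsupport ψ ⊆ Metric.closedBall 0 (1 / 4) := by
    have := tsupport_mul_subset_right (f := fun x : Space d => x i) (g := φ)
    rwa [φ.tsupport_eq, hrout, ← hψ] at this
  have hcs : HasCompactSupport ψ := hψ ▸ φ.hasCompactSupport.mul_left
  have ⟨M, hM₁, hM₂⟩ := exists_norm_fderiv_fderiv_le_of_hasCompactSupport hc hcs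
  have hle : ∀ x, |ψ x| ≤ |x i| := fun x => by
    simp only [hψ]
    rw [abs_mul, abs_of_nonneg φ.nonneg]
    exact mul_le_of_le_one_right (abs_nonneg _) φ.le_one
  have hout : ∀ x : Space d, 1 / 2 ≤ ‖x‖ → x ∉ Metric.closedBall (0 : Space d) (1 / 4) :=
    fun x hx h => by
      rw [mem_closedBall_zero_iff] at h
      linarith
  have hsub1 : tsupport (fderiv ℝ ψ) ⊆ Metric.closedBall 0 (1 / 4) :=
    (tsupport_fderiv_subset ℝ).trans hts
  have hsub2 : tsupport (fderiv ℝ (fderiv ℝ ψ)) ⊆ Metric.closedBall 0 (1 / 4) :=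
    (tsupport_fderiv_subset ℝ).trans hsub1
  have hzero : ∀ x, 1 / 2 ≤ ‖x‖ →
      ψ x = 0 ∧ fderiv ℝ ψ x = 0 ∧ fderiv ℝ (fderiv ℝ ψ) x = 0 := fun x hx =>
    ⟨image_eq_zero_of_notMem_tsupport fun h => hout x hx (hts h),
      image_eq_zero_of_notMem_tsupport fun h => hout x hx (hsub1 h),
      image_eq_zero_of_notMem_tsupport fun h => hout x hx (hsub2 h)⟩
  refine ⟨ψ, M, hc, (norm_nonneg _).trans (hM₁ 0),
    hc.continuous.integrable_of_hasCompactSupport hcs, ?_, ?_, fun x => ?_,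
    hM₁, hM₂, hzero⟩
  · have h1 : ∫ x, ψ (-x) = ∫ x, ψ x := integral_neg_eq_self ψ volume
    have h2 : ∀ x, ψ (-x) = -ψ x := fun x => by simp [hψ, φ.neg]
    simp_rw [h2] at h1
    rw [integral_neg] at h1
    linarith
  · refine hc.continuous.abs.integral_pos_of_hasCompactSupport_nonneg_nonzero
      (hcs.comp_left abs_zero) (fun x => abs_nonneg _) (x := EuclideanSpace.single i (1 / 8)) ?_
    have h1 : φ (EuclideanSpace.single i (1 / 8)) = 1 :=
      φ.one_of_mem_closedBall (by simp [hin])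
    simp only [hψ, h1]
    simp
  · rcases le_or_gt (1 / 2) ‖x‖ with h | h
    · rw [(hzero x h).1]; simp
    · have := PiLp.norm_apply_le x i
      rw [Real.norm_eq_abs] at this
      linarith [hle x]

/-! ### Rescaled bumps on a lattice. -/

theorem fderiv_const_smul_comp_inv_smul_sub {d : ℕ} {G : Type*} [NormedAddCommGroup G]
    [NormedSpace ℝ G] {F : Space d → G} (hF : Differentiable ℝ F) (c h : ℝ) (z : Space d) :
    fderiv ℝ (fun x => c • F (h⁻¹ • x - z)) =
      fun x => (c * h⁻¹) • fderiv ℝ F (h⁻¹ • x - z) := by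
  ext1 x
  have h1 : HasFDerivAt (fun x : Space d => h⁻¹ • x - z)
      (h⁻¹ • ContinuousLinearMap.id ℝ (Space d)) x :=
    ((hasFDerivAt_id x).const_smul h⁻¹).sub_const z
  have h2 : HasFDerivAt (fun x => c • F (h⁻¹ • x - z)) _ x :=
    ((hF (h⁻¹ • x - z)).hasFDerivAt.comp x h1).const_smul c
  rw [h2.fderiv]
  ext y
  simp [mul_smul]

theorem integral_comp_inv_smul_sub {d : ℕ} {h : ℝ} (hh : 0 < h) (F : Space d → ℝ) (z : Space d) :
    ∫ x, F (h⁻¹ • x - z) = h ^ d * ∫ x, F x := by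
  have := Measure.integral_comp_inv_smul_of_nonneg (volume : Measure (Space d))
    (fun y => F (y - z)) hh.le
  rw [this, integral_sub_right_eq_self, finrank_euclideanSpace_fin, smul_eq_mul]

theorem integrable_comp_inv_smul_sub {d : ℕ} {h : ℝ} (hh : 0 < h) {F : Space d → ℝ}
    (hF : Integrable F) (z : Space d) : Integrable fun x => F (h⁻¹ • x - z) :=
  (hF.comp_sub_right z).comp_smul (inv_ne_zero hh.ne')

/-- The point of the integer lattice with coordinates `k`. -/
def latticePoint {d m : ℕ} (k : Fin d → Fin m) : Space d :=
  WithLp.toLp 2 fun j => ((k j : ℕ) : ℝ)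

theorem norm_latticePoint_le {d m : ℕ} (k : Fin d → Fin m) :
    ‖latticePoint k‖ ≤ Real.sqrt d * m := by
  rw [EuclideanSpace.norm_eq]
  refine Real.sqrt_le_iff.mpr ⟨by positivity, ?_⟩
  rw [mul_pow, Real.sq_sqrt (by positivity)]
  calc ∑ j, ‖latticePoint k j‖ ^ 2 ≤ ∑ _j : Fin d, (m : ℝ) ^ 2 := by
        refine Finset.sum_le_sum fun j _ => ?_
        have : ((k j : ℕ) : ℝ) ≤ m := by exact_mod_cast (k j).2.le
        simp only [latticePoint, Real.norm_natCast]
        gcongr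
    _ = d * (m : ℝ) ^ 2 := by simp

theorem one_le_norm_latticePoint_sub {d m : ℕ} {k l : Fin d → Fin m} (h : k ≠ l) :
    1 ≤ ‖latticePoint k - latticePoint l‖ := by
  obtain ⟨j, hj⟩ := Function.ne_iff.mp h
  refine le_trans ?_ (PiLp.norm_apply_le (latticePoint k - latticePoint l) j)
  have hj' : ((k j : ℕ) : ℤ) - ((l j : ℕ) : ℤ) ≠ 0 := fun h0 => hj (Fin.ext (by omega))
  have := Int.one_le_abs hj'
  simp only [latticePoint, PiLp.sub_apply, Real.norm_eq_abs]
  exact_mod_cast this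

/-- Distinct lattice points are at distance at least 1, so the open balls of radius 1/2 around them
are disjoint; this separates the bumps. -/
theorem latticePoint_unique {d m : ℕ} {k l : Fin d → Fin m} {y : Space d}
    (hk : ‖y - latticePoint k‖ < 1 / 2) (hl : ‖y - latticePoint l‖ < 1 / 2) : k = l := by
  by_contra h
  have h1 := one_le_norm_latticePoint_sub h
  have h2 : latticePoint k - latticePoint l = (y - latticePoint l) - (y - latticePoint k) := by
    abel
  rw [h2] at h1
  linarith [norm_sub_le (y - latticePoint l) (y - latticePoint k)]

theorem norm_sum_le_of_subsingleton {ι G : Type*} [Fintype ι] [SeminormedAddCommGroup G]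
    {v : ι → G} {P : ι → Prop} (hP : ∀ i j, P i → P j → i = j) (h0 : ∀ i, ¬P i → v i = 0)
    {b : ℝ} (hb0 : 0 ≤ b) (hb : ∀ i, P i → ‖v i‖ ≤ b) : ‖∑ i, v i‖ ≤ b := by
  by_cases h : ∃ i, P i
  · obtain ⟨i, hi⟩ := h
    rw [Finset.sum_eq_single i (fun j _ hj => h0 j fun hPj => hj (hP j i hPj hi))
      fun h => absurd (Finset.mem_univ i) h]
    exact hb i hi
  · push Not at h
    rw [Finset.sum_eq_zero fun i _ => h0 i (h i), norm_zero]
    exact hb0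

/-- After termwise differentiation at most one bump contributes at `x`, so the bound for a single
bump passes to the sum whatever the number of bumps. -/
theorem norm_fderiv_signed_sum_le {E ι : Type*} [NormedAddCommGroup E] [NormedSpace ℝ E]
    [Fintype ι] {u : ι → E → ℝ} (hu : ∀ i, ContDiff ℝ 2 (u i)) {s : ι → ℝ}
    (hs : ∀ i, |s i| = 1) {x : E} {P : ι → Prop} (hP : ∀ i j, P i → P j → i = j)
    (h0 : ∀ i, ¬P i → fderiv ℝ (u i) x = 0 ∧ fderiv ℝ (fderiv ℝ (u i)) x = 0)
    {b : ℝ} (hb0 : 0 ≤ b)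
    (hb : ∀ i, P i → ‖fderiv ℝ (u i) x‖ ≤ b ∧ ‖fderiv ℝ (fderiv ℝ (u i)) x‖ ≤ b) :
    ‖fderiv ℝ (fun x => ∑ i, s i * u i x) x‖ ≤ b ∧
      ‖fderiv ℝ (fderiv ℝ fun x => ∑ i, s i * u i x) x‖ ≤ b := by
  have h1 : fderiv ℝ (fun x => ∑ i, s i * u i x) = fun x => ∑ i, s i • fderiv ℝ (u i) x := by
    ext1 x
    have : HasFDerivAt (fun x => ∑ i, s i * u i x) (∑ i, s i • fderiv ℝ (u i) x) x :=
      HasFDerivAt.fun_sum fun i _ =>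
        (((hu i).differentiable (by norm_num)) x).hasFDerivAt.const_mul (s i)
    exact this.fderiv
  have hd : ∀ i, DifferentiableAt ℝ (fderiv ℝ (u i)) x := fun i =>
    (((hu i).fderiv_right (m := 1) (by norm_num)).differentiable (by norm_num)) x
  have h2 : HasFDerivAt (fun x => ∑ i, s i • fderiv ℝ (u i) x)
      (∑ i, s i • fderiv ℝ (fderiv ℝ (u i)) x) x :=
    HasFDerivAt.fun_sum fun i _ => (hd i).hasFDerivAt.const_smul (s i)
  rw [h1, h2.fderiv]
  constructor
  · refine norm_sum_le_of_subsingleton hP (fun i hi => by rw [(h0 i hi).1, smul_zero]) hb0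
      fun i hi => ?_
    rw [norm_smul, Real.norm_eq_abs, hs, one_mul]
    exact (hb i hi).1
  · refine norm_sum_le_of_subsingleton (G := E →L[ℝ] E →L[ℝ] ℝ) hP
      (fun i hi => by rw [(h0 i hi).2, smul_zero]) hb0 fun i hi => ?_
    refine (ContinuousLinearMap.opNorm_smul_le _ _).trans ?_
    rw [Real.norm_eq_abs, hs, one_mul]
    exact (hb i hi).2

theorem fderiv_scaled_bump {d : ℕ} {ψ : Space d → ℝ} (hψ : ContDiff ℝ 2 ψ) (a h : ℝ)
    (z x : Space d) :
    fderiv ℝ (fun x => a * ψ (h⁻¹ • x - z)) x = (a * h⁻¹) • fderiv ℝ ψ (h⁻¹ • x - z) ∧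
    fderiv ℝ (fderiv ℝ fun x => a * ψ (h⁻¹ • x - z)) x =
      (a * h⁻¹ * h⁻¹) • fderiv ℝ (fderiv ℝ ψ) (h⁻¹ • x - z) := by
  have h1 : fderiv ℝ (fun x => a * ψ (h⁻¹ • x - z)) =
      fun x => (a * h⁻¹) • fderiv ℝ ψ (h⁻¹ • x - z) :=
    fderiv_const_smul_comp_inv_smul_sub (hψ.differentiable (by norm_num)) a h z
  rw [h1]
  exact ⟨rfl, congrFun (fderiv_const_smul_comp_inv_smul_sub (G := Space d →L[ℝ] ℝ)
    (differentiable_fderiv hψ) (a * h⁻¹) h z) x⟩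

theorem IsMeanZeroBump.norm_fderiv_scaled_le {d : ℕ} {ψ : Space d → ℝ} {M : ℝ}
    (hψ : IsMeanZeroBump ψ M) {a h : ℝ} (ha : 0 ≤ a) (hh : 0 < h) (z x : Space d) :
    ‖fderiv ℝ (fun x => a * ψ (h⁻¹ • x - z)) x‖ ≤ a * h⁻¹ * M ∧
    ‖fderiv ℝ (fderiv ℝ fun x => a * ψ (h⁻¹ • x - z)) x‖ ≤ a * h⁻¹ * h⁻¹ * M := by
  rw [(fderiv_scaled_bump hψ.contDiff a h z x).1, (fderiv_scaled_bump hψ.contDiff a h z x).2]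
  refine ⟨(ContinuousLinearMap.opNorm_smul_le _ _).trans ?_,
    (ContinuousLinearMap.opNorm_smul_le _ _).trans ?_⟩
  · rw [Real.norm_of_nonneg (by positivity)]
    exact mul_le_mul_of_nonneg_left (hψ.norm_fderiv_le _) (by positivity)
  · rw [Real.norm_of_nonneg (by positivity)]
    exact mul_le_mul_of_nonneg_left (hψ.norm_fderiv_fderiv_le _) (by positivity)

/-! ### The lower bound for given height and width. -/

/-- The lower bound from perturbations of width `h` in a region where the density is of
order `v`. -/
theorem exists_le_minimaxL1Risk {d : ℕ} (hd : 1 ≤ d) {β : ℝ} (hβ0 : 0 < β) (hβ1 : β ≤ 1)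
    (hβd : β = 1 → d ≤ 2) :
    ∃ C₀ c : ℝ, 0 < C₀ ∧ 0 < c ∧
      ∀ v h : ℝ, 0 < v → v ≤ 1 → 0 < h → h ≤ 1 →
      ∀ N : ℕ, 1 ≤ N → v * h ^ (d + 4) ≤ 1 / N →
      ∀ Cb Cc Cd : ℝ, C₀ ≤ Cb → C₀ ≤ Cc → C₀ ≤ Cd →
        ENNReal.ofReal (c * (v ^ β * h ^ 2)) ≤ minimaxL1Risk d N β Cb Cc Cd := by
  obtain ⟨D, κ, hD, hκ0, hκ1, hbase⟩ := exists_base_density hd hβ0 hβ1 hβd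
  obtain ⟨ψ, M, hψ⟩ := exists_isMeanZeroBump hd
  have hM := hψ.bound_nonneg
  have hψJ := hψ.integral_abs_pos
  set J : ℝ := ∫ x, |ψ x| with hJ
  -- Small enough for `ε ≤ κ / 2`, which keeps the bumps below `f / 2`, and for `ε² J ≤ κ / 2`,
  -- which keeps a single sign undetectable.
  set ε : ℝ := κ / (2 * (1 + J)) with hε
  have hε0 : 0 < ε := by positivity
  have hεJ : ε * (2 * (1 + J)) = κ := by rw [hε]; field_simp
  have hεκ : ε ≤ κ / 2 := by nlinarith [mul_pos hε0 hψJ]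
  have hεJκ : ε ^ 2 * J ≤ κ / 2 := by nlinarith [mul_pos hε0 hψJ]
  -- The first constant dominates both constants of `TailProfile.add_perturbation`. In the second,
  -- 1/8 comes from Assouad's lemma and `2 ^ d` from rounding `L / h` down.
  refine ⟨2 * (8 + M) + 4 * D, ε * J / (8 * 2 ^ d), by positivity, by positivity, ?_⟩
  intro v h hv hv1 hh hh1 N hN hvh Cb Cc Cd hCb hCc hCd
  obtain ⟨L, f, hL1, hvL, hprof, hmass, hf23, hfκ⟩ := hbase v hv hv1
  have hN0 : (0 : ℝ) < N := by exact_mod_cast hN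
  have hL0 : 0 < L := by linarith
  set m : ℕ := ⌊L / h⌋₊ with hm
  have hLh : 1 ≤ L / h := by rw [le_div_iff₀ hh]; linarith
  have hmle : (m : ℝ) ≤ L / h := Nat.floor_le (by positivity)
  have hmge : L / 2 ≤ m * h := by
    have h1 : L / h < m + 1 := Nat.lt_floor_add_one _
    have h2 : (1 : ℝ) ≤ m := by exact_mod_cast Nat.one_le_floor_iff _ |>.mpr hLh
    rw [div_lt_iff₀ hh] at h1
    nlinarith
  -- Two derivatives cost `h⁻²`, so this height makes the Hessian of order `v`, comparable to the
  -- density.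
  set a : ℝ := ε * v * h ^ 2 with ha
  have ha0 : 0 < a := by positivity
  set u : (Fin d → Fin m) → Space d → ℝ := fun k x => a * ψ (h⁻¹ • x - latticePoint k) with hu
  have hfar : ∀ k x, ¬‖h⁻¹ • x - latticePoint k‖ < 1 / 2 → u k x = 0 := fun k x hx => by
    simp only [hu]
    rw [(hψ.eq_zero _ (not_lt.mp hx)).1, mul_zero]
  have hnear : ∀ (k : Fin d → Fin m) x, ‖h⁻¹ • x - latticePoint k‖ < 1 / 2 → κ * v ≤ f x := by
    intro k x hx
    refine hfκ x ?_
    have h1 : ‖h⁻¹ • x‖ ≤ Real.sqrt d * (L / h) + 1 / 2 := by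
      have h2 := norm_sub_norm_le (h⁻¹ • x) (latticePoint k)
      have h3 : ‖latticePoint k‖ ≤ Real.sqrt d * (L / h) :=
        (norm_latticePoint_le k).trans (by gcongr)
      linarith
    have h4 : L⁻¹ • x = (h / L) • (h⁻¹ • x) := by
      rw [smul_smul]
      congr 1
      field_simp
    rw [h4, norm_smul, Real.norm_of_nonneg (by positivity)]
    have h5 : h / L ≤ 1 := by rw [div_le_one hL0]; linarith
    calc h / L * ‖h⁻¹ • x‖ ≤ h / L * (Real.sqrt d * (L / h) + 1 / 2) := by gcongr
      _ = Real.sqrt d + h / L * (1 / 2) := by field_simp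
      _ ≤ Real.sqrt d + 1 := by linarith
  have hmem : ∀ k x, u k x ≠ 0 → ‖h⁻¹ • x - latticePoint k‖ < 1 / 2 := fun k x hx => by
    by_contra h'
    exact hx (hfar k x h')
  have huc : ∀ k, ContDiff ℝ 2 (u k) := fun k =>
    contDiff_const.mul (hψ.contDiff.comp ((contDiff_const_smul h⁻¹).sub contDiff_const))
  have hahh : a ≤ κ * v / 2 := by
    have h1 : h ^ 2 ≤ 1 := pow_le_one₀ hh.le hh1
    have h2 : ε * v ≤ κ / 2 * v := by gcongr
    nlinarith [mul_le_mul_of_nonneg_left h1 (mul_pos hε0 hv).le]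
  have hua : ∀ k x, |u k x| ≤ κ * v / 2 := fun k x => by
    simp only [hu]
    rw [abs_mul, abs_of_pos ha0]
    exact (mul_le_of_le_one_right ha0.le (hψ.abs_le_one _)).trans hahh
  have hui : ∀ k, Integrable (u k) := fun k =>
    (integrable_comp_inv_smul_sub hh hψ.integrable (latticePoint k)).const_mul a
  have hκv : 0 < κ * v := by positivity
  have hfam : IsBumpFamily (κ * v) f u :=
    { pos := hκv
      measurable_base := hprof.measurable
      nonneg_base := hprof.nonneg
      lintegral_base := hmass
      measurable_bump := fun k => (huc k).continuous.measurable
      integrable_bump := hui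
      integral_bump := fun k => by
        simp only [hu]
        rw [integral_const_mul, integral_comp_inv_smul_sub hh, hψ.integral_eq_zero, mul_zero, mul_zero]
      abs_bump_le := fun k x => (hua k x).trans (by linarith)
      le_base := fun k x hx => hnear k x (hmem k x hx)
      disjoint := fun k l x hkl hx => by
        by_contra hx'
        exact hkl (latticePoint_unique (hmem k x hx) (hmem l x hx')) }
  have hsq : ∀ k, (∫ x, u k x ^ 2) ≤ κ * v / (2 * N) := fun k => by
    have h1 : ∀ x, u k x ^ 2 = a ^ 2 * (fun y => ψ y ^ 2) (h⁻¹ • x - latticePoint k) := fun x => by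
      simp only [hu]; ring
    have h2 : ∫ x, ψ x ^ 2 ≤ J := by
      refine integral_mono_of_nonneg (Filter.Eventually.of_forall fun x => sq_nonneg _)
        hψ.integrable.abs (Filter.Eventually.of_forall fun x => ?_)
      show ψ x ^ 2 ≤ |ψ x|
      rw [← sq_abs]
      nlinarith [abs_nonneg (ψ x), hψ.abs_le_one x]
    simp_rw [h1]
    rw [integral_const_mul, integral_comp_inv_smul_sub hh fun y => ψ y ^ 2]
    -- The constraint on `v` and `h` enters here: `a² h ^ d` is `ε² v` times `v * h ^ (d + 4)`.
    calc a ^ 2 * (h ^ d * ∫ x, ψ x ^ 2) ≤ a ^ 2 * (h ^ d * J) := by gcongr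
      _ = (ε ^ 2 * J) * v * (v * h ^ (d + 4)) := by rw [ha]; ring
      _ ≤ (κ / 2) * v * (1 / N) := by gcongr
      _ = κ * v / (2 * N) := by field_simp
  have hεv : ε * v ≤ κ * v := by nlinarith
  have hah1 : a * h⁻¹ ≤ κ * v := by
    calc a * h⁻¹ = ε * v * h := by rw [ha]; field_simp
      _ ≤ ε * v := mul_le_of_le_one_right (by positivity) hh1
      _ ≤ _ := hεv
  have hah2 : a * h⁻¹ * h⁻¹ ≤ κ * v := by
    calc a * h⁻¹ * h⁻¹ = ε * v := by rw [ha]; field_simp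
      _ ≤ _ := hεv
  have hclass : ∀ σ, IsSmoothTailDensity β Cb Cc Cd (perturbed f u σ) := fun σ => by
    have hwle : ∀ x, |∑ k, boolSign (σ k) * u k x| ≤ f x / 2 := fun x => by
      rw [← Real.norm_eq_abs]
      refine norm_sum_le_of_subsingleton (fun k l => latticePoint_unique)
        (fun k hk => by rw [hfar k x hk, mul_zero])
        (div_nonneg (hprof.nonneg x) (by norm_num)) fun k hk => ?_
      rw [Real.norm_eq_abs, abs_mul, abs_boolSign, one_mul]
      linarith [hua k x, hnear k x hk]
    have hder : ∀ x, ‖fderiv ℝ (fun x => ∑ k, boolSign (σ k) * u k x) x‖ ≤ M * f x ∧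
        ‖fderiv ℝ (fderiv ℝ fun x => ∑ k, boolSign (σ k) * u k x) x‖ ≤ M * f x := fun x => by
      refine norm_fderiv_signed_sum_le huc (fun k => abs_boolSign (σ k))
        (fun k l => latticePoint_unique (y := h⁻¹ • x)) (fun k hk => ?_)
        (mul_nonneg hM (hprof.nonneg x)) fun k hk => ?_
      · have ⟨_, z1, z2⟩ := hψ.eq_zero _ (not_lt.mp hk)
        have ⟨e1, e2⟩ := fderiv_scaled_bump hψ.contDiff a h (latticePoint k) x
        rw [z1, smul_zero] at e1
        rw [z2, smul_zero] at e2
        exact ⟨e1, e2⟩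
      · have ⟨b1, b2⟩ :=
          hψ.norm_fderiv_scaled_le ha0.le hh (latticePoint k) x
        have hκf := hnear k x hk
        refine ⟨b1.trans ?_, b2.trans ?_⟩
        · rw [mul_comm]
          exact mul_le_mul_of_nonneg_left (hah1.trans hκf) hM
        · rw [mul_comm]
          exact mul_le_mul_of_nonneg_left (hah2.trans hκf) hM
    have hp := hprof.add_perturbation (w := fun x => ∑ k, boolSign (σ k) * u k x) hβ1
      (by norm_num) hD.le (ContDiff.sum fun k _ => contDiff_const.mul (huc k)) hM hwle
      (fun x => by linarith [(abs_le.mp (hwle x)).2, hf23 x])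
      (fun x => (hder x).1) fun x => (hder x).2
    exact hp.isSmoothTailDensity (hfam.lintegral_perturbed σ) (by linarith) (by linarith)
      (by linarith)
  refine le_iInf fun fhat => ?_
  obtain ⟨σ, hσ⟩ := hfam.exists_l1Risk_ge hN hsq fhat
  refine le_trans ?_ (hσ.trans (le_iSup₂_of_le (perturbed f u σ) (hclass σ) le_rfl))
  have habs : ∀ k, ∫⁻ x, ENNReal.ofReal |u k x| = ENNReal.ofReal (a * (h ^ d * J)) := fun k => by
    rw [← ofReal_integral_eq_lintegral_ofReal (hui k).abs
      (Filter.Eventually.of_forall fun x => abs_nonneg _)]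
    congr 1
    simp only [hu, abs_mul, abs_of_pos ha0]
    rw [integral_const_mul, integral_comp_inv_smul_sub hh fun y => |ψ y|]
  simp_rw [habs]
  rw [Finset.sum_const, Finset.card_univ, Fintype.card_fun, Fintype.card_fin, Fintype.card_fin,
    nsmul_eq_mul, show (1 / 8 : ℝ≥0∞) = ENNReal.ofReal (1 / 8) by
      rw [ENNReal.ofReal_div_of_pos (by norm_num)]; norm_num,
    ← ENNReal.ofReal_natCast, ← ENNReal.ofReal_mul (by positivity),
    ← ENNReal.ofReal_mul (by norm_num)]
  refine ENNReal.ofReal_le_ofReal ?_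
  push_cast
  -- There are `m ^ d` bumps of `L¹` norm `a h ^ d J`. Since `m h ≥ L / 2`, they cover a volume of
  -- order `L ^ d`, and `v * L ^ d = v ^ β`.
  calc ε * J / (8 * 2 ^ d) * (v ^ β * h ^ 2)
      = 1 / 8 * ((L / 2) ^ d * (ε * v * h ^ 2 * J)) := by
        rw [← hvL, div_pow]; field_simp
    _ ≤ 1 / 8 * ((m * h) ^ d * (ε * v * h ^ 2 * J)) := by gcongr
    _ = _ := by rw [mul_pow, ha]; ring

end DensityEstimation

end

/-! ### Choice of height and width. -/

theorem theorem4 (d : ℕ) (hd : 1 ≤ d) (β : ℝ) (hβ0 : 0 < β) (hβ1 : β ≤ 1)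
    (hβd : β = 1 → d ≤ 2) :
    ∃ C₀ c : ℝ, 0 < C₀ ∧ 0 < c ∧
      ∀ Cb Cc Cd : ℝ, C₀ ≤ Cb → C₀ ≤ Cc → C₀ ≤ Cd →
        ∀ N : ℕ, 1 ≤ N →
          ENNReal.ofReal (c * (N : ℝ) ^ (-(min β (2 / ((d : ℝ) + 4))))) ≤
            DensityEstimation.minimaxL1Risk d N β Cb Cc Cd := by
  obtain ⟨C₀, c, hC₀, hc, H⟩ := DensityEstimation.exists_le_minimaxL1Risk hd hβ0 hβ1 hβd
  refine ⟨C₀, c, hC₀, hc, fun Cb Cc Cd hCb hCc hCd N hN => ?_⟩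
  have hN1 : (1 : ℝ) ≤ N := by exact_mod_cast hN
  have hN0 : (0 : ℝ) < N := by linarith
  rcases le_total β (2 / ((d : ℝ) + 4)) with hle | hle
  · rw [min_eq_left hle]
    -- Tail regime: unit-width bumps where the density is of order `1 / N`, so that a cell receives
    -- a bounded number of samples on average.
    have h := H (1 / N) 1 (by positivity) ((div_le_one hN0).mpr hN1) one_pos le_rfl N hN
      (by simp) Cb Cc Cd hCb hCc hCd
    rw [one_pow, mul_one, one_div, Real.inv_rpow hN0.le, ← Real.rpow_neg hN0.le] at h
    exact h
  · rw [min_eq_right hle]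
    have hd4 : (0 : ℝ) < (d : ℝ) + 4 := by positivity
    -- Smoothness regime: density of order 1, and the largest width allowed by `h ^ (d + 4) ≤ 1 /
    -- N`.
    have h := H 1 ((N : ℝ) ^ (-(1 / ((d : ℝ) + 4)))) one_pos le_rfl (by positivity)
      (Real.rpow_le_one_of_one_le_of_nonpos hN1 (neg_nonpos.mpr (by positivity))) N hN
      (by
        rw [one_mul, ← Real.rpow_natCast, ← Real.rpow_mul hN0.le]
        push_cast
        rw [neg_mul, one_div_mul_cancel hd4.ne', Real.rpow_neg_one, one_div])
      Cb Cc Cd hCb hCc hCd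
    rw [Real.one_rpow, one_mul, ← Real.rpow_natCast, ← Real.rpow_mul hN0.le] at h
    convert h using 4
    push_cast
    ring
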